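/- Let $G_\infty=(V_\infty,E_\infty)$ be an infinite graph without loops and multiple edges, with weights $W_{ij}=W_{ji}\ge 0$, $W_{ij}>0$ if and only if $i\sim j$, and $\sum_j W_{ij}<\infty$ for all $i\in V_\infty$. Let $V_n\uparrow V_\infty$ ($n\in\mathbb N$) be finite sets. The wired graph $\tilde G_n$ has vertex set $\tilde V_n=V_n\cup\{\delta_n\}$, contains the edges of $G_\infty$ inside $V_n$, and an edge between $i\in V_n$ and $\delta_n$ whenever $i$ has a neighbour in $V_\infty\setminus V_n$; its weights are $W^{(n)}_{ij}=W_{ij}$ for $i,j\in V_n$, $W^{(n)}_{i\delta_n}=W^{(n)}_{\delta_n i}=\sum_{j\in V_\infty\setminus V_n}W_{ij}$ and $W^{(n)}_{\delta_n\delta_n}=0$. Assume that every $\tilde G_n$ is connected (for instance, that $G_\infty$ is connected). *Finite volume.* Let $\tilde V=V\cup\{\delta\}$ be the vertex set of a finite connected graph with edge set $\tilde E$ and symmetric weights $W$ on $\tilde V\times\tilde V$, positive exactly on the edges. For $u,s\in\mathbb R^{\tilde V}$ with $u_\delta=s_\delta=0$ let $A^W_{ij}(u)=-W_{ij}e^{u_i+u_j}$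 for $i\ne j$, $A^W_{ii}(u)=\sum_{k\in\tilde V}W_{ik}e^{u_i+u_k}$, and let $A^W_{VV}(u)$ be the restriction of $A^W(u)$ to $V\times V$. The (marginal) $H^{2|2}$ measure is $$\mu^W(du\,ds)=e^{-\frac12\langle s,A^W(u)s\rangle}\det A^W_{VV}(u)\prod_{(i\sim j)\in\tilde E}e^{-W_{ij}[\cosh(u_i-u_j)-1]}\prod_{i\in V}\frac{e^{-u_i}}{2\pi}\,du_i\,ds_i .$$ For $i\in V$ put $\beta_i(u)=\frac12\sum_{j\in\tilde V}W_{ij}e^{u_j-u_i}$ and $\theta_i(u,s)=e^{-u_i}(A^W_{VV}(u)s_V)_i$. There are measurable maps $f^W_V$, $g^W_V$ with $u=f^W_V(\beta(u))$ and $s=g^W_V(\beta(u),\theta(u,s))$: with $H_\beta=2\,\mathrm{diag}(\beta)-W_{VV}$ one has $e^{u_V}=H_{\beta}^{-1}W_{V\delta}$, and $s_V=A^W_{VV}(u)^{-1}(e^{u_i}\theta_i)_{i\in V}$. *Infinite volume.* Let $\boldsymbol\beta_i,\boldsymbol\theta_i$, $i\in V_\infty$, be real random variables on a probability space such that, for every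 $n$, the law of $(\boldsymbol\beta^{(n)},\boldsymbol\theta^{(n)})=((\boldsymbol\beta_i)_{i\in V_n},(\boldsymbol\theta_i)_{i\in V_n})$ is the law of $(\beta,\theta)$ under the measure $\mu^{W^{(n)}}$ of $\tilde G_n$. Put $u^{(n)}=f^{W^{(n)}}_{V_n}(\boldsymbol\beta^{(n)})$, $s^{(n)}=g^{W^{(n)}}_{V_n}(\boldsymbol\beta^{(n)},\boldsymbol\theta^{(n)})$ on $V_n$ and $u^{(n)}_i=s^{(n)}_i=0$ for $i\in V_\infty\setminus V_n$. Then for all $k\in\mathbb N$ and $j_1,\dots,j_k\in V_\infty$, the process $$M^{(n)}_{j_1,\dots,j_k}=\prod_{l=1}^k e^{u^{(n)}_{j_l}}\bigl(1+is^{(n)}_{j_l}\bigr),\qquad n\in\mathbb N,$$ and its real and imaginary parts are martingales with respect to the filtration $\mathcal F_n=\sigma(\boldsymbol\beta^{(n)},\boldsymbol\theta^{(n)})$. In particular, for every $j\in V_\infty$, $\bigl(s^{(n)}_je^{u^{(n)}_j}\bigr)_{n}$ and $\bigl(e^{2u^{(n)}_j}(1-(s^{(n)}_j)^2)\bigr)_{n}$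 are martingales with respect to $(\mathcal F_n)_n$. -/

import Mathlib

open MeasureTheory ProbabilityTheory

noncomputable section

namespace HypSigma

/-! Finite volume. The vertex set is `Option ι`: the vertices in `V` are `some i`, the
distinguished vertex `δ` is `none`. Edge weights vanish off the edges. -/

/-- Extension of a vector on `V` to the full vertex set by the pinned value `0` at `δ`. -/
def pin {ι : Type*} (x : ι → ℝ) : Option ι → ℝ
  | none => 0
  | some i => x i

/-- The matrix `A^W(u)` on the full vertex set. -/
def matA {ι : Type*} [Fintype ι] [DecidableEq ι] (W : Option ι → Option ι → ℝ)
    (u : Option ι → ℝ) : Matrix (Option ι) (Option ι) ℝ :=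
  Matrix.of fun i j =>
    if i = j then ∑ k, W i k * Real.exp (u i + u k) else -(W i j * Real.exp (u i + u j))

/-- The restriction `A^W_{VV}(u)`. -/
def matAV {ι : Type*} [Fintype ι] [DecidableEq ι] (W : Option ι → Option ι → ℝ)
    (u : Option ι → ℝ) : Matrix ι ι ℝ :=
  (matA W u).submatrix some some

/-- The density `ρ^W(u,s)`. The product over the undirected edges is written as the exponential
of half of the sum over ordered pairs of vertices (`W` is symmetric). -/
def rho {ι : Type*} [Fintype ι] [DecidableEq ι] (W : Option ι → Option ι → ℝ)
    (u s : Option ι → ℝ) : ℝ :=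
  Real.exp (-(1 / 2) * (s ⬝ᵥ (matA W u).mulVec s)) * (matAV W u).det *
    Real.exp (-(1 / 2) * ∑ i, ∑ j, W i j * (Real.cosh (u i - u j) - 1))

/-- The measure `μ^W(du ds) = ρ^W(u,s) ∏_{i ∈ V} (2π)⁻¹ e^{-u_i} du_i ds_i`, in the coordinates
`(u_i)_{i ∈ V}`, `(s_i)_{i ∈ V}`; the coordinates at `δ` are pinned to `0`. -/
def mu {ι : Type*} [Fintype ι] [DecidableEq ι] (W : Option ι → Option ι → ℝ) :
    Measure ((ι → ℝ) × (ι → ℝ)) :=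
  volume.withDensity fun x =>
    ENNReal.ofReal (rho W (pin x.1) (pin x.2) * ∏ i, (1 / (2 * Real.pi) * Real.exp (-x.1 i)))

/-- `β_i(u) = ½ ∑_j W_{ij} e^{u_j - u_i}` for `i ∈ V`. -/
def betaV {ι : Type*} [Fintype ι] (W : Option ι → Option ι → ℝ) (u : Option ι → ℝ) : ι → ℝ :=
  fun i => 1 / 2 * ∑ j, W (some i) j * Real.exp (u j - u (some i))

/-- `θ(u,s) = e^{-u}_{VV} A_{VV}(u) s_V`. -/
def thetaV {ι : Type*} [Fintype ι] [DecidableEq ι] (W : Option ι → Option ι → ℝ)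
    (u s : Option ι → ℝ) : ι → ℝ :=
  (Matrix.diagonal fun i => Real.exp (-u (some i))).mulVec
    ((matAV W u).mulVec fun i => s (some i))

/-- The matrix `H_β = 2 diag(β) - W_{VV}`. -/
def matH {ι : Type*} [DecidableEq ι] (W : Option ι → Option ι → ℝ) (β : ι → ℝ) : Matrix ι ι ℝ :=
  Matrix.diagonal (fun i => 2 * β i) - Matrix.of fun i j => W (some i) (some j)

/-- The measurable map `f_V^W` with `f_V^W(β(u)) = u`: one has `e^{u_V} = H_β⁻¹ W_{Vδ}`
and `u_δ = 0` (see `uOfBeta_betaV` and `measurable_uOfBeta` below). -/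
def uOfBeta {ι : Type*} [Fintype ι] [DecidableEq ι] (W : Option ι → Option ι → ℝ)
    (β : ι → ℝ) : Option ι → ℝ :=
  pin fun i => Real.log ((matH W β)⁻¹.mulVec (fun j => W (some j) none) i)

/-- The map `g_V^W`: `s_V = A_{VV}(u)⁻¹ e^u_{VV} θ` with `u = f_V^W(β)`, and `s_δ = 0`. -/
def sOfBetaTheta {ι : Type*} [Fintype ι] [DecidableEq ι] (W : Option ι → Option ι → ℝ)
    (β θ : ι → ℝ) : Option ι → ℝ :=
  pin ((matAV W (uOfBeta W β))⁻¹.mulVec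
    ((Matrix.diagonal fun i => Real.exp (uOfBeta W β (some i))).mulVec θ))

section Facts

theorem matAV_mulVec {ι : Type*} [Fintype ι] [DecidableEq ι] (W : Option ι → Option ι → ℝ)
    (hdiag : ∀ i, W i i = 0) (u : Option ι → ℝ) (v : ι → ℝ) (i : ι) :
    (matAV W u).mulVec v i =
      ∑ j, W (some i) j * Real.exp (u (some i) + u j) * (v i - pin v j) := by
  have h1 : ∀ j : ι, matAV W u i j * v j =
      (if i = j then (∑ k, W (some i) k * Real.exp (u (some i) + u k)) * v i else 0)
        - W (some i) (some j) * Real.exp (u (some i) + u (some j)) * v j := by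
    intro j
    by_cases h : i = j
    · subst h
      simp [matAV, matA, hdiag]
    · simp [matAV, matA, h]
  rw [Matrix.mulVec, dotProduct, Finset.sum_congr rfl fun j _ => h1 j, Finset.sum_sub_distrib]
  simp only [Finset.sum_ite_eq, Finset.mem_univ, if_true, mul_sub, Finset.sum_sub_distrib,
    Finset.sum_mul]
  congr 1
  rw [Fintype.sum_option]
  simp [pin]

theorem isUnit_matAV {ι : Type*} [Fintype ι] [DecidableEq ι] (W : Option ι → Option ι → ℝ)
    (G : SimpleGraph (Option ι)) (hG : G.Connected) (hsymm : ∀ i j, W i j = W j i)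
    (hpos : ∀ i j, G.Adj i j → 0 < W i j) (hzero : ∀ i j, ¬ G.Adj i j → W i j = 0)
    (u : Option ι → ℝ) : IsUnit (matAV W u) := by
  have hdiag : ∀ i, W i i = 0 := fun i => hzero i i (G.loopless.irrefl i)
  rw [← Matrix.mulVec_injective_iff_isUnit]
  refine (injective_iff_map_eq_zero (Matrix.mulVecLin (matAV W u))).2 fun v hv => ?_
  have hv' : ∀ i, ∑ j, W (some i) j * Real.exp (u (some i) + u j) * (v i - pin v j) = 0 := by
    intro i
    rw [← matAV_mulVec W hdiag u v i]
    exact congrFun hv i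
  have h0 : ∑ i, ∑ j, W i j * Real.exp (u i + u j) * (pin v i - pin v j) * pin v i = 0 := by
    rw [Fintype.sum_option]
    have : ∀ i, ∑ j, W (some i) j * Real.exp (u (some i) + u j) *
        (pin v (some i) - pin v j) * pin v (some i) = 0 := by
      intro i
      rw [← Finset.sum_mul]
      have := hv' i
      simp only [pin] at this ⊢
      rw [this, zero_mul]
    rw [Finset.sum_eq_zero fun i _ => this i]
    simp [pin]
  have h1 : ∑ i, ∑ j, W i j * Real.exp (u i + u j) * (pin v i - pin v j) * pin v j = 0 := by
    rw [Finset.sum_comm, ← neg_eq_zero, ← h0]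
    simp only [← Finset.sum_neg_distrib]
    refine Finset.sum_congr rfl fun i _ => Finset.sum_congr rfl fun j _ => ?_
    rw [hsymm j i, add_comm (u j)]
    ring
  have h2 : ∑ i, ∑ j, W i j * Real.exp (u i + u j) * (pin v i - pin v j) ^ 2 = 0 := by
    rw [← sub_zero (0 : ℝ)]
    nth_rewrite 1 [← h0]
    nth_rewrite 1 [← h1]
    simp only [← Finset.sum_sub_distrib]
    refine Finset.sum_congr rfl fun i _ => Finset.sum_congr rfl fun j _ => ?_
    ring
  have hnn : ∀ i j, 0 ≤ W i j * Real.exp (u i + u j) * (pin v i - pin v j) ^ 2 := by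
    intro i j
    have : 0 ≤ W i j := by
      by_cases h : G.Adj i j
      · exact (hpos i j h).le
      · exact (hzero i j h).ge
    positivity
  have h3 : ∀ i j, G.Adj i j → pin v i = pin v j := by
    intro i j hij
    have a := (Finset.sum_eq_zero_iff_of_nonneg
      (fun i _ => Finset.sum_nonneg fun j _ => hnn i j)).1 h2 i (Finset.mem_univ _)
    have b := (Finset.sum_eq_zero_iff_of_nonneg (fun j _ => hnn i j)).1 a j (Finset.mem_univ _)
    have c : W i j * Real.exp (u i + u j) ≠ 0 := (mul_pos (hpos i j hij) (Real.exp_pos _)).ne'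
    have d := pow_eq_zero_iff (two_ne_zero) |>.1 ((mul_eq_zero.1 b).resolve_left c)
    linarith
  funext i
  obtain ⟨p⟩ := hG.preconnected (some i) none
  have h4 : ∀ {a b : Option ι}, G.Walk a b → pin v a = pin v b := by
    intro a b p
    induction p with
    | nil => rfl
    | cons h _ ih => exact (h3 _ _ h).trans ih
  exact h4 p

/-- `f_V^W(β(u)) = u` whenever `u_δ = 0` and the graph is connected. -/
theorem uOfBeta_betaV {ι : Type*} [Fintype ι] [DecidableEq ι] (W : Option ι → Option ι → ℝ)
    (G : SimpleGraph (Option ι)) (hG : G.Connected) (hsymm : ∀ i j, W i j = W j i)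
    (hpos : ∀ i j, G.Adj i j → 0 < W i j) (hzero : ∀ i j, ¬ G.Adj i j → W i j = 0)
    (u : ι → ℝ) : uOfBeta W (betaV W (pin u)) = pin u := by
  have hdiag : ∀ i, W i i = 0 := fun i => hzero i i (G.loopless.irrefl i)
  set D : Matrix ι ι ℝ := Matrix.diagonal fun i => Real.exp (-u i) with hD
  have hH : matH W (betaV W (pin u)) = D * matAV W (pin u) * D := by
    ext i j
    rw [hD, Matrix.mul_diagonal, Matrix.diagonal_mul]
    by_cases h : i = j
    · subst h
      simp only [matH, betaV, matAV, matA, pin, Matrix.sub_apply, Matrix.diagonal_apply_eq,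
        Matrix.of_apply, hdiag, Matrix.submatrix_apply, if_true, Finset.mul_sum, Finset.sum_mul,
        sub_zero]
      refine Finset.sum_congr rfl fun k _ => ?_
      rw [Real.exp_add, Real.exp_sub, Real.exp_neg]
      field_simp
    · simp only [matH, matAV, matA, pin, Matrix.sub_apply, Matrix.diagonal_apply_ne _ h,
        Matrix.of_apply, Matrix.submatrix_apply, Option.some.injEq, h, if_false, zero_sub]
      rw [Real.exp_add, Real.exp_neg, Real.exp_neg]
      field_simp
  have hDu : IsUnit D := by
    rw [Matrix.isUnit_iff_isUnit_det, hD, Matrix.det_diagonal, isUnit_iff_ne_zero]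
    exact Finset.prod_ne_zero_iff.2 fun i _ => (Real.exp_pos _).ne'
  have hHu : IsUnit (matH W (betaV W (pin u))) := by
    rw [hH]
    exact (hDu.mul (isUnit_matAV W G hG hsymm hpos hzero _)).mul hDu
  have hw : (fun j => W (some j) none) =
      (matH W (betaV W (pin u))).mulVec fun i => Real.exp (u i) := by
    funext i
    simp only [matH, Matrix.sub_mulVec, Pi.sub_apply, Matrix.mulVec_diagonal]
    simp only [betaV, Matrix.mulVec, dotProduct, Matrix.of_apply]
    rw [Fintype.sum_option]
    simp only [pin, mul_add, add_mul, Finset.mul_sum, Finset.sum_mul, Real.exp_sub, Real.exp_zero]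
    have : ∀ j, 2 * (1 / 2 * (W (some i) (some j) * (Real.exp (u j) / Real.exp (u i)))) *
        Real.exp (u i) = W (some i) (some j) * Real.exp (u j) := by
      intro j
      field_simp
    simp only [this]
    field_simp
    ring
  have hsol : (matH W (betaV W (pin u)))⁻¹.mulVec (fun j => W (some j) none) =
      fun i => Real.exp (u i) := by
    rw [hw, Matrix.mulVec_mulVec,
      Matrix.nonsing_inv_mul _ ((Matrix.isUnit_iff_isUnit_det _).1 hHu), Matrix.one_mulVec]
  unfold uOfBeta
  rw [hsol]
  simp

/-- `g_V^W(β(u), θ(u,s)) = s` whenever `u_δ = s_δ = 0` and the graph is connected. -/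
theorem sOfBetaTheta_betaV_thetaV {ι : Type*} [Fintype ι] [DecidableEq ι]
    (W : Option ι → Option ι → ℝ)
    (G : SimpleGraph (Option ι)) (hG : G.Connected) (hsymm : ∀ i j, W i j = W j i)
    (hpos : ∀ i j, G.Adj i j → 0 < W i j) (hzero : ∀ i j, ¬ G.Adj i j → W i j = 0)
    (u s : ι → ℝ) :
    sOfBetaTheta W (betaV W (pin u)) (thetaV W (pin u) (pin s)) = pin s := by
  have hA := (Matrix.isUnit_iff_isUnit_det _).1 (isUnit_matAV W G hG hsymm hpos hzero (pin u))
  unfold sOfBetaTheta thetaV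
  rw [uOfBeta_betaV W G hG hsymm hpos hzero u, Matrix.mulVec_mulVec _ (Matrix.diagonal _),
    Matrix.diagonal_mul_diagonal]
  simp only [← Real.exp_add, add_neg_cancel, Real.exp_zero, Matrix.diagonal_one,
    Matrix.one_mulVec, Matrix.mulVec_mulVec, Matrix.one_mul, Matrix.nonsing_inv_mul _ hA]
  rfl

theorem measurable_inv_apply {ι α : Type*} [Fintype ι] [DecidableEq ι] [MeasurableSpace α]
    (M : α → Matrix ι ι ℝ) (hM : ∀ i j, Measurable fun a => M a i j) (i j : ι) :
    Measurable fun a => (M a)⁻¹ i j := by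
  have hdet : ∀ N : α → Matrix ι ι ℝ, (∀ i j, Measurable fun a => N a i j) →
      Measurable fun a => (N a).det := by
    intro N hN
    simp only [Matrix.det_apply']
    exact Finset.measurable_sum _ fun σ _ =>
      (Finset.measurable_prod _ fun k _ => hN _ _).const_mul _
  simp only [Matrix.inv_def, Matrix.smul_apply, Ring.inverse_eq_inv', smul_eq_mul,
    Matrix.adjugate_apply]
  refine (hdet M hM).inv.mul (hdet _ fun k l => ?_)
  by_cases h : k = j
  · subst h
    simp
  · simpa [Matrix.updateRow_ne h] using hM k l

theorem measurable_pin {ι α : Type*} [MeasurableSpace α] (x : α → ι → ℝ) (hx : Measurable x) :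
    Measurable fun a => pin (x a) := by
  refine measurable_pi_lambda _ fun i => ?_
  cases i with
  | none => exact measurable_const
  | some i => exact (measurable_pi_apply i).comp hx

theorem measurable_uOfBeta {ι : Type*} [Fintype ι] [DecidableEq ι]
    (W : Option ι → Option ι → ℝ) : Measurable (uOfBeta W) := by
  refine measurable_pin _ (measurable_pi_lambda _ fun i => Real.measurable_log.comp ?_)
  refine Finset.measurable_sum _ fun j _ => Measurable.mul_const ?_ _
  refine measurable_inv_apply _ (fun k l => ?_) i j
  by_cases h : k = l
  · subst h
    simp only [matH, Matrix.sub_apply, Matrix.diagonal_apply_eq, Matrix.of_apply]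
    fun_prop
  · simp only [matH, Matrix.sub_apply, Matrix.diagonal_apply_ne _ h]
    fun_prop

theorem measurable_sOfBetaTheta {ι : Type*} [Fintype ι] [DecidableEq ι]
    (W : Option ι → Option ι → ℝ) :
    Measurable fun x : (ι → ℝ) × (ι → ℝ) => sOfBetaTheta W x.1 x.2 := by
  have hu : ∀ j, Measurable fun x : (ι → ℝ) × (ι → ℝ) => uOfBeta W x.1 j := fun j =>
    (measurable_pi_apply j).comp ((measurable_uOfBeta W).comp measurable_fst)
  refine measurable_pin _ (measurable_pi_lambda _ fun i => ?_)
  refine Finset.measurable_sum _ fun j _ => Measurable.mul ?_ ?_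
  · refine measurable_inv_apply _ (fun k l => ?_) i j
    simp only [matAV, matA, Matrix.submatrix_apply, Matrix.of_apply]
    split_ifs
    · exact Finset.measurable_sum _ fun m _ => by fun_prop
    · fun_prop
  · simp only [Matrix.mulVec_diagonal]
    fun_prop

end Facts

/-! Infinite volume. -/

/-- The finite graph on `S ∪ {δ}` obtained from `G` by wired boundary conditions:
`i ∈ S` is joined to `δ` if and only if `i` has a neighbour outside of `S`. -/
def wiredGraph {V : Type*} (G : SimpleGraph V) (S : Finset V) : SimpleGraph (Option S) where
  Adj
    | some i, some j => G.Adj i j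
    | some i, none => ∃ j, j ∉ S ∧ G.Adj i j
    | none, some i => ∃ j, j ∉ S ∧ G.Adj i j
    | none, none => False
  symm := ⟨by
    rintro (_ | i) (_ | j) h
    · exact h
    · exact h
    · exact h
    · exact SimpleGraph.Adj.symm h⟩
  loopless := ⟨by
    rintro (_ | i) h
    · exact h
    · exact G.loopless.irrefl _ h⟩

/-- The weights of the wired graph. -/
def wiredWeight {V : Type*} (W : V → V → ℝ) (S : Finset V) : Option S → Option S → ℝ
  | some i, some j => W i j
  | some i, none => ∑' j : {j : V // j ∉ S}, W i j
  | none, some i => ∑' j : {j : V // j ∉ S}, W i j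
  | none, none => 0

/-- The random vector `(𝛃^{(n)}, 𝛉^{(n)})`, the restriction of `(𝛃, 𝛉)` to a finite set `S`. -/
def restr {V Ω : Type*} (S : Finset V) (β θ : V → Ω → ℝ) (ω : Ω) : (S → ℝ) × (S → ℝ) :=
  (fun i => β i ω, fun i => θ i ω)

/-- For every `n`, the law of `(𝛃^{(n)}, 𝛉^{(n)})` under `P` is the law of
`(β^{V_n}, θ^{V_n})` under `μ_n^W`. -/
def HasInfiniteVolumeLaw {V Ω : Type*} [DecidableEq V] [MeasurableSpace Ω] (W : V → V → ℝ)
    (Vn : ℕ → Finset V) (P : Measure Ω) (β θ : V → Ω → ℝ) : Prop :=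
  ∀ n, P.map (restr (Vn n) β θ) =
    (mu (wiredWeight W (Vn n))).map fun x =>
      (betaV (wiredWeight W (Vn n)) (pin x.1), thetaV (wiredWeight W (Vn n)) (pin x.1) (pin x.2))

theorem measurable_restr {V Ω : Type*} [MeasurableSpace Ω] (S : Finset V) (β θ : V → Ω → ℝ)
    (hβ : ∀ i, Measurable (β i)) (hθ : ∀ i, Measurable (θ i)) : Measurable (restr S β θ) := by
  unfold restr
  exact (measurable_pi_lambda _ fun i : S => hβ i).prodMk
    (measurable_pi_lambda _ fun i : S => hθ i)

/-- The filtration `F_n = σ(𝛃^{(n)}, 𝛉^{(n)})`. -/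
def filt {V Ω : Type*} [m : MeasurableSpace Ω] (Vn : ℕ → Finset V) (hVn : Monotone Vn)
    (β θ : V → Ω → ℝ) (hβ : ∀ i, Measurable (β i)) (hθ : ∀ i, Measurable (θ i)) :
    Filtration ℕ m where
  seq n := MeasurableSpace.comap (restr (Vn n) β θ) inferInstance
  mono' := by
    intro n k hnk
    have h : restr (Vn n) β θ =
        (fun x : (Vn k → ℝ) × (Vn k → ℝ) =>
          ((fun i : Vn n => x.1 ⟨i, hVn hnk i.2⟩), (fun i : Vn n => x.2 ⟨i, hVn hnk i.2⟩))) ∘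
          restr (Vn k) β θ := rfl
    change MeasurableSpace.comap (restr (Vn n) β θ) _ ≤ MeasurableSpace.comap (restr (Vn k) β θ) _
    rw [h, ← MeasurableSpace.comap_comp]
    refine MeasurableSpace.comap_mono (Measurable.comap_le ?_)
    fun_prop
  le' n := (measurable_restr (Vn n) β θ hβ hθ).comap_le

/-- `u^{(n)}_j` for `S = V_n`; it is `0` for `j ∉ V_n`. -/
def uField {V Ω : Type*} [DecidableEq V] (W : V → V → ℝ) (S : Finset V) (β θ : V → Ω → ℝ)
    (j : V) (ω : Ω) : ℝ :=
  if h : j ∈ S then uOfBeta (wiredWeight W S) (restr S β θ ω).1 (some ⟨j, h⟩) else 0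

/-- `s^{(n)}_j` for `S = V_n`; it is `0` for `j ∉ V_n`. -/
def sField {V Ω : Type*} [DecidableEq V] (W : V → V → ℝ) (S : Finset V) (β θ : V → Ω → ℝ)
    (j : V) (ω : Ω) : ℝ :=
  if h : j ∈ S then
    sOfBetaTheta (wiredWeight W S) (restr S β θ ω).1 (restr S β θ ω).2 (some ⟨j, h⟩)
  else 0

/-- `M^{(n)}_{j_1,…,j_k} = ∏_l e^{u^{(n)}_{j_l}} (1 + i s^{(n)}_{j_l})` for `S = V_n`. -/
def prodM {V Ω : Type*} [DecidableEq V] (W : V → V → ℝ) (S : Finset V) (β θ : V → Ω → ℝ)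
    {k : ℕ} (j : Fin k → V) (ω : Ω) : ℂ :=
  ∏ l, (Real.exp (uField W S β θ (j l) ω) : ℂ) *
    (1 + Complex.I * (sField W S β θ (j l) ω : ℂ))

end HypSigma

end

/-!
Write `H = H_β` and `η_i = W_{iδ}`. Since `H_{β(u)} = e^{-u} A_{VV}(u) e^{-u}`, the complex field is
`e^{u_j} (1 + i s_j) = (H⁻¹ (η + i θ))_j`. The range of `u ↦ β(u)` is the set where `H_β` is positive
definite (`range_betaV`), and the change of variables `(u, s) ↦ (β, θ)` turns `μ^W` into the measure
`nu` with the Lebesgue density (`map_mu`)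
`π^{-|V|} (det H)⁻¹ exp (-½ ⟨1, H 1⟩ + ⟨1, η⟩ - ½ ⟨η, H⁻¹ η⟩ - ½ ⟨θ, H⁻¹ θ⟩)`.

In these coordinates the passage from a network to a smaller one, with some vertices merged into `δ`,
is a Schur complement. Consider one additional vertex `x` with variables `(b, t)`. Let `c` be the
vector of weights between `x` and the old vertices, `g = 2 b - ⟨c, H⁻¹ c⟩` the Schur complement,
`a = η_x + ⟨c, H⁻¹ η⟩` the effective pinning, and `t̂ = t + ⟨c, H⁻¹ θ⟩`. The density factorizes into
the density of the smaller network and `π⁻¹ g⁻¹ exp (a - g / 2 - (a² + t̂²) / (2 g))`, on `g > 0`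
(`IsContraction.nuDensity_extend`). The complex field at `x` is `y = (a + i t̂) / g`, the one at the
old vertices is affine in `y`, and for `y = 1` it is the complex field of the smaller network.
Hence the conditional expectation of a product of complex fields is that of a polynomial in `y`, and
everything reduces to the statement that all moments of `y` under the law of a single vertex are
equal to `1` (`integral_vertexKernel`). To see this, let `J_m(a)` be the unnormalized `m`-th moment.
The operator `∂_a + i ∂_t` annihilates the powers of `a + i t` and acts on the exponential weight as
multiplication by `-y`, so that an integration by parts in `t` gives `J_m' = -J_{m+1}`, while
`J_0(a) = 2 π e^{-a}` by the Cauchy-Schlömilch substitution.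

The fields are integrable by Gaussian bounds in the coordinates `(u, s)` (`exists_bound_rho`), which
come from the coercivity of the Dirichlet form of a connected network. Connectivity also makes the
effective pinning positive, by the maximum principle. Since connectivity of a wired graph on `S` says
that every nonempty subset of `S` has an edge to its complement (`HasExits`), it is inherited by
subsets of `S`, and the vertices of `V_m \ V_n` can be eliminated one at a time
(`setIntegral_prod_field_wired`).
-/

noncomputable section

namespace HypSigma

/-! ### The integral over the variables of a single vertex -/

/-- The weight of a single vertex with pinning `a`, in the variables `(g, t)`, times the `m`-th
power of the complex field `(a + i t) / g`. -/
def vertexKernel (m : ℕ) (a : ℝ) (x : ℝ × ℝ) : ℂ :=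
  (((a : ℂ) + Complex.I * (x.2 : ℂ)) / (x.1 : ℂ)) ^ m *
    ((Real.exp (-(x.1 / 2) - (a ^ 2 + x.2 ^ 2) / (2 * x.1)) / x.1 : ℝ) : ℂ)

/-- The reference measure for a single vertex: Lebesgue measure on `g > 0`, `t ∈ ℝ`. -/
def vertexMeasure : Measure (ℝ × ℝ) := (volume.restrict (Set.Ioi (0 : ℝ))).prod volume

instance : SFinite vertexMeasure := by unfold vertexMeasure; infer_instance

theorem ae_vertexMeasure_pos : ∀ᵐ x ∂vertexMeasure, 0 < x.1 := by
  have h : ∀ᵐ g ∂(volume.restrict (Set.Ioi (0 : ℝ))), 0 < g :=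
    ae_restrict_mem measurableSet_Ioi
  exact Measure.quasiMeasurePreserving_fst.ae h

theorem measurable_vertexKernel (m : ℕ) (a : ℝ) : Measurable (vertexKernel m a) := by
  unfold vertexKernel
  fun_prop

/-- The factor `exp (-(a² + t²) / (2 g))` absorbs the singularity at `g = 0`, because of
`z ^ (m + 1) ≤ (m + 1)! e ^ z` with `z = (a² + t²) / (2 g)`; the bound is uniform in `a ≥ b`. -/
theorem norm_vertexKernel_le (m : ℕ) {a b : ℝ} (hb : 0 < b) (hab : b ≤ a) {x : ℝ × ℝ}
    (hx : 0 < x.1) :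
    ‖vertexKernel m a x‖ ≤ ((m + 1).factorial * 2 ^ (m + 1) / b ^ m) *
      (Real.exp (-(1 / 2) * x.1) * (b ^ 2 + x.2 ^ 2)⁻¹) := by
  obtain ⟨g, t⟩ := x
  simp only at hx
  have ha : 0 < a := hb.trans_le hab
  set R := a ^ 2 + t ^ 2 with hR
  have hR0 : 0 < R := by positivity
  set r := Real.sqrt R with hr
  have hr2 : r ^ 2 = R := Real.sq_sqrt hR0.le
  have hr0 : 0 < r := Real.sqrt_pos.2 hR0
  have hbr : b ≤ r := Real.le_sqrt_of_sq_le (by nlinarith [sq_nonneg t])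
  have hnorm : ‖((a : ℂ) + Complex.I * (t : ℂ))‖ = r := by
    rw [mul_comm, Complex.norm_add_mul_I]
  have h1 : ‖vertexKernel m a (g, t)‖ =
      r ^ m / g ^ (m + 1) * (Real.exp (-(1 / 2) * g) * Real.exp (-(R / (2 * g)))) := by
    simp only [vertexKernel, norm_mul, norm_pow, norm_div, hnorm, Complex.norm_real,
      Real.norm_eq_abs, abs_of_pos hx, Real.abs_exp]
    rw [← Real.exp_add, div_pow, pow_succ g m, show -(g / 2) - (a ^ 2 + t ^ 2) / (2 * g) =
      -(1 / 2) * g + -(R / (2 * g)) by rw [hR]; ring]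
    field_simp
  have h2 : Real.exp (-(R / (2 * g))) ≤ (m + 1).factorial * (2 * g / R) ^ (m + 1) := by
    have h := Real.pow_div_factorial_le_exp (R / (2 * g)) (by positivity) (m + 1)
    rw [Real.exp_neg]
    rw [div_le_iff₀ (by positivity)] at h
    rw [inv_le_iff_one_le_mul₀ (Real.exp_pos _)]
    calc (1 : ℝ) = (R / (2 * g)) ^ (m + 1) * (2 * g / R) ^ (m + 1) := by
          rw [← mul_pow]; field_simp; simp
      _ ≤ (Real.exp (R / (2 * g)) * (m + 1).factorial) * (2 * g / R) ^ (m + 1) := by gcongr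
      _ = _ := by ring
  rw [h1]
  calc r ^ m / g ^ (m + 1) * (Real.exp (-(1 / 2) * g) * Real.exp (-(R / (2 * g))))
      ≤ r ^ m / g ^ (m + 1) * (Real.exp (-(1 / 2) * g) *
          ((m + 1).factorial * (2 * g / R) ^ (m + 1))) := by gcongr
    _ = ((m + 1).factorial * 2 ^ (m + 1) / r ^ m) * (Real.exp (-(1 / 2) * g) * R⁻¹) := by
        rw [← hr2, div_pow, mul_pow, ← pow_mul]; field_simp; ring
    _ ≤ ((m + 1).factorial * 2 ^ (m + 1) / b ^ m) *
          (Real.exp (-(1 / 2) * g) * (b ^ 2 + t ^ 2)⁻¹) := by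
        have : b ^ 2 + t ^ 2 ≤ R := by rw [hR]; gcongr
        gcongr

theorem integrable_inv_sq_add_sq {b : ℝ} (hb : 0 < b) :
    Integrable fun t : ℝ => (b ^ 2 + t ^ 2)⁻¹ := by
  have h := (integrable_inv_one_add_sq.comp_div hb.ne').const_mul ((b ^ 2)⁻¹)
  refine h.congr (Filter.Eventually.of_forall fun t => ?_)
  simp only
  rw [← mul_inv]
  congr 1
  field_simp

theorem integrable_vertexBound (C : ℝ) {b : ℝ} (hb : 0 < b) :
    Integrable (fun x : ℝ × ℝ => C * (Real.exp (-(1 / 2) * x.1) * (b ^ 2 + x.2 ^ 2)⁻¹))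
      vertexMeasure := by
  have h : IntegrableOn (fun g : ℝ => Real.exp (-(1 / 2) * g)) (Set.Ioi 0) :=
    integrableOn_exp_mul_Ioi (by norm_num) 0
  exact (Integrable.mul_prod h (integrable_inv_sq_add_sq hb)).const_mul C

theorem integrable_vertexKernel (m : ℕ) {a : ℝ} (ha : 0 < a) :
    Integrable (vertexKernel m a) vertexMeasure := by
  refine (integrable_vertexBound ((m + 1).factorial * 2 ^ (m + 1) / a ^ m) ha).mono'
    (measurable_vertexKernel m a).aestronglyMeasurable ?_
  filter_upwards [ae_vertexMeasure_pos] with x hx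
  exact norm_vertexKernel_le m ha le_rfl hx

/-- The part of `∂_a vertexKernel` in which the derivative falls on the power of the complex field.
The exponent `m - 1` is irrelevant for `m = 0`, because of the factor `m`. -/
def vertexKernelAux (m : ℕ) (a : ℝ) (x : ℝ × ℝ) : ℂ :=
  (m : ℂ) * ((((a : ℂ) + Complex.I * (x.2 : ℂ)) / (x.1 : ℂ)) ^ (m - 1) / (x.1 : ℂ)) *
    ((Real.exp (-(x.1 / 2) - (a ^ 2 + x.2 ^ 2) / (2 * x.1)) / x.1 : ℝ) : ℂ)

theorem hasDerivAt_vertexKernel_left (m : ℕ) (a : ℝ) {x : ℝ × ℝ} (hx : 0 < x.1) :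
    HasDerivAt (fun a => vertexKernel m a x)
      (vertexKernelAux m a x - (a / x.1 : ℝ) * vertexKernel m a x) a := by
  obtain ⟨g, t⟩ := x
  simp only at hx
  have h1 : HasDerivAt (fun a : ℝ => ((a : ℂ) + Complex.I * (t : ℂ)) / (g : ℂ)) (1 / (g : ℂ)) a :=
    ((Complex.ofRealCLM.hasDerivAt (x := a)).add_const _).div_const _
  have h2 : HasDerivAt (fun a : ℝ =>
      Real.exp (-(g / 2) - (a ^ 2 + t ^ 2) / (2 * g)) / g)
      (Real.exp (-(g / 2) - (a ^ 2 + t ^ 2) / (2 * g)) * (-(a / g)) / g) a := by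
    have : HasDerivAt (fun a : ℝ => -(g / 2) - (a ^ 2 + t ^ 2) / (2 * g)) (-(a / g)) a := by
      have := ((((hasDerivAt_id a).pow 2).add_const (t ^ 2)).div_const (2 * g)).const_sub (-(g / 2))
      refine this.congr_deriv ?_
      simp; field_simp
    exact this.exp.div_const g
  refine ((h1.pow m).mul h2.ofReal_comp).congr_deriv ?_
  simp only [vertexKernelAux, vertexKernel, Pi.pow_apply]
  push_cast
  ring

theorem hasDerivAt_vertexKernel_right (m : ℕ) (a g t : ℝ) (hg : 0 < g) :
    HasDerivAt (fun t => vertexKernel m a (g, t))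
      (Complex.I * vertexKernelAux m a (g, t) - (t / g : ℝ) * vertexKernel m a (g, t)) t := by
  have h1 : HasDerivAt (fun t : ℝ => ((a : ℂ) + Complex.I * (t : ℂ)) / (g : ℂ))
      (Complex.I / (g : ℂ)) t := by
    have := (((Complex.ofRealCLM.hasDerivAt (x := t)).const_mul Complex.I).const_add
      (a : ℂ)).div_const (g : ℂ)
    refine this.congr_deriv (by simp)
  have h2 : HasDerivAt (fun t : ℝ =>
      Real.exp (-(g / 2) - (a ^ 2 + t ^ 2) / (2 * g)) / g)
      (Real.exp (-(g / 2) - (a ^ 2 + t ^ 2) / (2 * g)) * (-(t / g)) / g) t := by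
    have : HasDerivAt (fun t : ℝ => -(g / 2) - (a ^ 2 + t ^ 2) / (2 * g)) (-(t / g)) t := by
      have := ((((hasDerivAt_id t).pow 2).const_add (a ^ 2)).div_const (2 * g)).const_sub (-(g / 2))
      refine this.congr_deriv ?_
      simp; field_simp
    exact this.exp.div_const g
  refine ((h1.pow m).mul h2.ofReal_comp).congr_deriv ?_
  simp only [vertexKernelAux, vertexKernel, Pi.pow_apply]
  push_cast
  ring

theorem vertexKernel_succ (m : ℕ) (a : ℝ) (x : ℝ × ℝ) :
    vertexKernel (m + 1) a x =
      ((a : ℂ) + Complex.I * (x.2 : ℂ)) / (x.1 : ℂ) * vertexKernel m a x := by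
  simp only [vertexKernel, pow_succ]
  ring

/-- A factor `1 / g` is controlled by one more power of the field, as `|(a + i t) / g| ≥ b / g`. -/
theorem norm_vertexKernel_div_le (m : ℕ) {a b : ℝ} (hb : 0 < b) (hab : b ≤ a) {x : ℝ × ℝ}
    (hx : 0 < x.1) : ‖vertexKernel m a x‖ / x.1 ≤ ‖vertexKernel (m + 1) a x‖ / b := by
  have h : b ≤ ‖((a : ℂ) + Complex.I * (x.2 : ℂ))‖ := by
    refine hab.trans ((le_abs_self a).trans ?_)
    simpa using Complex.abs_re_le_norm ((a : ℂ) + Complex.I * (x.2 : ℂ))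
  rw [vertexKernel_succ, norm_mul, norm_div, Complex.norm_real, Real.norm_eq_abs, abs_of_pos hx,
    div_le_div_iff₀ hx hb]
  calc ‖vertexKernel m a x‖ * b
      ≤ ‖vertexKernel m a x‖ * ‖((a : ℂ) + Complex.I * (x.2 : ℂ))‖ := by gcongr
    _ = _ := by field_simp

theorem norm_vertexKernelAux_le (m : ℕ) {a b : ℝ} (hb : 0 < b) (hab : b ≤ a) {x : ℝ × ℝ}
    (hx : 0 < x.1) : ‖vertexKernelAux m a x‖ ≤ m * (‖vertexKernel m a x‖ / b) := by
  cases m with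
  | zero => simp [vertexKernelAux]
  | succ m =>
    have h : vertexKernelAux (m + 1) a x = ((m + 1 : ℕ) : ℂ) * (vertexKernel m a x / (x.1 : ℂ)) := by
      simp only [vertexKernelAux, vertexKernel, Nat.add_sub_cancel]
      ring
    rw [h, norm_mul, norm_div, Complex.norm_real, Real.norm_eq_abs, abs_of_pos hx,
      Complex.norm_natCast]
    exact mul_le_mul_of_nonneg_left (norm_vertexKernel_div_le m hb hab hx) (Nat.cast_nonneg _)

theorem measurable_vertexKernelAux (m : ℕ) (a : ℝ) : Measurable (vertexKernelAux m a) := by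
  unfold vertexKernelAux
  fun_prop

theorem integrable_vertexKernelAux (m : ℕ) {a : ℝ} (ha : 0 < a) :
    Integrable (vertexKernelAux m a) vertexMeasure := by
  refine (((integrable_vertexKernel m ha).norm.div_const a).const_mul (m : ℝ)).mono'
    (measurable_vertexKernelAux m a).aestronglyMeasurable ?_
  filter_upwards [ae_vertexMeasure_pos] with x hx
  exact norm_vertexKernelAux_le m ha le_rfl hx

theorem integrable_deriv_vertexKernel_right (m : ℕ) {a : ℝ} (ha : 0 < a) :
    Integrable (fun x : ℝ × ℝ => Complex.I * vertexKernelAux m a x -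
      (x.2 / x.1 : ℝ) * vertexKernel m a x) vertexMeasure := by
  refine ((integrable_vertexKernelAux m ha).const_mul _).sub ?_
  refine (integrable_vertexKernel (m + 1) ha).norm.mono' ?_ ?_
  · have := measurable_vertexKernel m a
    exact Measurable.aestronglyMeasurable (by fun_prop)
  filter_upwards [ae_vertexMeasure_pos] with x hx
  rw [vertexKernel_succ, norm_mul, norm_mul]
  gcongr
  rw [norm_div, Complex.norm_real, Complex.norm_real, norm_div]
  gcongr
  have := Complex.abs_im_le_norm ((a : ℂ) + Complex.I * (x.2 : ℂ))
  simpa using this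

/-- The integral of a total derivative in the variable `t` vanishes. -/
theorem integral_deriv_vertexKernel_right (m : ℕ) {a : ℝ} (ha : 0 < a) :
    ∫ x, (Complex.I * vertexKernelAux m a x - (x.2 / x.1 : ℝ) * vertexKernel m a x)
      ∂vertexMeasure = 0 := by
  have h1 := integrable_deriv_vertexKernel_right m ha
  have h0 := integrable_vertexKernel m ha
  unfold vertexMeasure at h0 h1 ⊢
  rw [integral_prod _ h1]
  refine integral_eq_zero_of_ae ?_
  filter_upwards [h1.prod_right_ae, h0.prod_right_ae, ae_restrict_mem measurableSet_Ioi]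
    with g hg1 hg0 hg
  exact integral_eq_zero_of_hasDerivAt_of_integrable
    (fun t => hasDerivAt_vertexKernel_right m a g t hg) hg1 hg0

/-- Differentiation in the pinning raises the power of the complex field: the `∂_a` and `i ∂_t`
derivatives of the prefactor cancel. -/
theorem hasDerivAt_integral_vertexKernel (m : ℕ) {a : ℝ} (ha : 0 < a) :
    HasDerivAt (fun a => ∫ x, vertexKernel m a x ∂vertexMeasure)
      (-∫ x, vertexKernel (m + 1) a x ∂vertexMeasure) a := by
  set b := a / 2 with hbdef
  have hb : 0 < b := by positivity
  set C : ℕ → ℝ := fun m => (m + 1).factorial * 2 ^ (m + 1) / b ^ m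
  have hC : ∀ m, 0 ≤ C m := fun m => by positivity
  have key := hasDerivAt_integral_of_dominated_loc_of_deriv_le (μ := vertexMeasure) (𝕜 := ℝ)
    (F := fun a x => vertexKernel m a x)
    (F' := fun a x => vertexKernelAux m a x - (a / x.1 : ℝ) * vertexKernel m a x)
    (x₀ := a) (s := Set.Ioo b (2 * a))
    (bound := fun x => (m * (C m / b) + 2 * a * (C (m + 1) / b)) *
      (Real.exp (-(1 / 2) * x.1) * (b ^ 2 + x.2 ^ 2)⁻¹))
    (Ioo_mem_nhds (by rw [hbdef]; linarith) (by linarith))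
    (Filter.Eventually.of_forall fun a => (measurable_vertexKernel m a).aestronglyMeasurable)
    (integrable_vertexKernel m ha) ?_ ?_ (integrable_vertexBound _ hb) ?_
  · refine key.2.congr_deriv ?_
    have h3 := integral_deriv_vertexKernel_right m ha
    rw [← sub_zero (∫ x, _ ∂vertexMeasure), ← mul_zero (-Complex.I), ← h3,
      ← integral_const_mul, ← integral_sub key.1
        ((integrable_deriv_vertexKernel_right m ha).const_mul _), ← integral_neg]
    refine integral_congr_ae (Filter.Eventually.of_forall fun x => ?_)
    simp only [vertexKernel_succ]
    push_cast
    linear_combination (vertexKernelAux m a x) * (Complex.I_mul_I)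
  · have h1 := measurable_vertexKernel m a
    have h2 := measurable_vertexKernelAux m a
    exact Measurable.aestronglyMeasurable (by fun_prop)
  · filter_upwards [ae_vertexMeasure_pos] with x hx a' ha'
    have hab : b ≤ a' := ha'.1.le
    have ha0 : 0 < a' := hb.trans ha'.1
    set B := Real.exp (-(1 / 2) * x.1) * (b ^ 2 + x.2 ^ 2)⁻¹ with hB
    have hB0 : 0 ≤ B := by positivity
    have e1 : ‖vertexKernelAux m a' x‖ ≤ m * (C m / b) * B := by
      refine (norm_vertexKernelAux_le m hb hab hx).trans ?_
      rw [mul_assoc, div_mul_eq_mul_div]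
      gcongr
      exact norm_vertexKernel_le m hb hab hx
    have e2 : ‖((a' / x.1 : ℝ) : ℂ) * vertexKernel m a' x‖ ≤ 2 * a * (C (m + 1) / b) * B := by
      have e3 : ‖vertexKernel m a' x‖ / x.1 ≤ C (m + 1) * B / b :=
        (norm_vertexKernel_div_le m hb hab hx).trans
          (div_le_div_of_nonneg_right (norm_vertexKernel_le (m + 1) hb hab hx) hb.le)
      rw [norm_mul, Complex.norm_real, Real.norm_eq_abs, abs_of_pos (by positivity),
        div_mul_eq_mul_div, mul_div_assoc, mul_assoc, div_mul_eq_mul_div]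
      exact mul_le_mul ha'.2.le e3 (by positivity) (by positivity)
    rw [add_mul]
    exact (norm_sub_le _ _).trans (add_le_add e1 e2)
  · filter_upwards [ae_vertexMeasure_pos] with x hx a' ha'
    exact hasDerivAt_vertexKernel_left m a' hx

/-- Cauchy-Schlömilch: the map `r ↦ r - a / r` of `(0, ∞)` onto `ℝ` and the inversion
`r ↦ a / r` evaluate the integral. -/
theorem integral_exp_sq_sub_div {a : ℝ} (ha : 0 < a) :
    ∫ r in Set.Ioi (0 : ℝ), Real.exp (-(1 / 2) * (r - a / r) ^ 2) = Real.sqrt (2 * Real.pi) / 2 ∧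
    IntegrableOn (fun r : ℝ => Real.exp (-(1 / 2) * (r - a / r) ^ 2)) (Set.Ioi 0) := by
  have hd : ∀ r ∈ Set.Ioi (0 : ℝ), HasDerivWithinAt (fun r : ℝ => r - a / r) (1 + a / r ^ 2)
      (Set.Ioi 0) r := by
    intro r hr
    have hr : r ≠ 0 := ne_of_gt hr
    have := ((hasDerivAt_id r).sub ((hasDerivAt_inv hr).const_mul a)).hasDerivWithinAt
      (s := Set.Ioi 0)
    refine this.congr_deriv ?_
    field_simp
    ring
  have hdi : ∀ r ∈ Set.Ioi (0 : ℝ), HasDerivWithinAt (fun r : ℝ => a / r) (-(a / r ^ 2))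
      (Set.Ioi 0) r := by
    intro r hr
    have hr : r ≠ 0 := ne_of_gt hr
    have := ((hasDerivAt_inv hr).const_mul a).hasDerivWithinAt (s := Set.Ioi 0)
    refine this.congr_deriv ?_
    field_simp
  have himi : (fun r : ℝ => a / r) '' Set.Ioi 0 = Set.Ioi 0 := by
    ext x
    constructor
    · rintro ⟨r, hr, rfl⟩
      exact div_pos ha hr
    · intro hx
      exact ⟨a / x, div_pos ha hx, by simp only; field_simp⟩
  have hinji : Set.InjOn (fun r : ℝ => a / r) (Set.Ioi 0) := by
    intro x hx y hy h
    have hx : (0 : ℝ) < x := hx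
    have hy : (0 : ℝ) < y := hy
    simp only at h
    field_simp at h
    linarith
  have hinj : Set.InjOn (fun r : ℝ => r - a / r) (Set.Ioi 0) := by
    intro x hx y hy h
    have hx : (0 : ℝ) < x := hx
    have hy : (0 : ℝ) < y := hy
    simp only at h
    field_simp at h
    have h' : (x - y) * (x * y + a) = 0 := by linarith
    rcases mul_eq_zero.1 h' with h' | h'
    · linarith
    · nlinarith [mul_pos hx hy]
  have him : (fun r : ℝ => r - a / r) '' Set.Ioi 0 = Set.univ := by
    refine Set.eq_univ_of_forall fun x => ?_
    have hs : |x| < Real.sqrt (x ^ 2 + 4 * a) := by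
      rw [← Real.sqrt_sq_eq_abs]
      exact Real.sqrt_lt_sqrt (by positivity) (by linarith)
    have hpos : 0 < x + Real.sqrt (x ^ 2 + 4 * a) := by linarith [neg_abs_le x]
    refine ⟨(x + Real.sqrt (x ^ 2 + 4 * a)) / 2, half_pos hpos, ?_⟩
    have h2 := Real.sq_sqrt (show 0 ≤ x ^ 2 + 4 * a by positivity)
    simp only
    field_simp
    nlinarith
  set f : ℝ → ℝ := fun x => Real.exp (-(1 / 2) * x ^ 2) with hf
  have hfi : Integrable f := integrable_exp_neg_mul_sq (by norm_num)
  have hI := integral_image_eq_integral_abs_deriv_smul measurableSet_Ioi hd hinj f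
  have hInt := (integrableOn_image_iff_integrableOn_abs_deriv_smul measurableSet_Ioi hd hinj f).1
    (by rw [him]; exact hfi.integrableOn)
  have hmeas : Measurable fun r : ℝ => Real.exp (-(1 / 2) * (r - a / r) ^ 2) := by fun_prop
  have hInt1 : IntegrableOn (fun r : ℝ => Real.exp (-(1 / 2) * (r - a / r) ^ 2)) (Set.Ioi 0) := by
    refine Integrable.mono' hInt hmeas.aestronglyMeasurable ?_
    filter_upwards [ae_restrict_mem measurableSet_Ioi] with r hr
    have hr : (0 : ℝ) < r := hr
    rw [Real.norm_eq_abs, Real.abs_exp, smul_eq_mul, abs_of_pos (by positivity)]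
    have : (0 : ℝ) ≤ a / r ^ 2 := by positivity
    simp only [hf]
    nlinarith [Real.exp_pos (-(1 / 2) * (r - a / r) ^ 2)]
  have hInv := integral_image_eq_integral_abs_deriv_smul measurableSet_Ioi hdi hinji
    (fun r : ℝ => Real.exp (-(1 / 2) * (r - a / r) ^ 2))
  rw [himi] at hInv
  have hInt2 := (integrableOn_image_iff_integrableOn_abs_deriv_smul measurableSet_Ioi hdi hinji
    (fun r : ℝ => Real.exp (-(1 / 2) * (r - a / r) ^ 2))).1 (by rw [himi]; exact hInt1)
  refine ⟨?_, hInt1⟩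
  have htot : ∫ r in Set.Ioi (0 : ℝ), |1 + a / r ^ 2| • f (r - a / r) =
      (∫ r in Set.Ioi (0 : ℝ), Real.exp (-(1 / 2) * (r - a / r) ^ 2)) +
      ∫ r in Set.Ioi (0 : ℝ), Real.exp (-(1 / 2) * (r - a / r) ^ 2) := by
    nth_rewrite 2 [hInv]
    rw [← integral_add hInt1 hInt2]
    refine setIntegral_congr_fun measurableSet_Ioi fun r hr => ?_
    have hr : (0 : ℝ) < r := hr
    simp only [hf, smul_eq_mul]
    rw [abs_of_pos (by positivity), abs_neg, abs_of_pos (by positivity),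
      show a / (a / r) = r by field_simp, show (a / r - r) ^ 2 = (r - a / r) ^ 2 by ring]
    ring
  rw [him, setIntegral_univ, htot, hf, integral_gaussian] at hI
  rw [show 2 * Real.pi = Real.pi / (1 / 2) by ring]
  linarith

theorem integral_vertexKernel_zero {a : ℝ} (ha : 0 < a) :
    ∫ x, vertexKernel 0 a x ∂vertexMeasure = ((2 * Real.pi * Real.exp (-a) : ℝ) : ℂ) := by
  have h0 := integrable_vertexKernel 0 ha
  unfold vertexMeasure at h0 ⊢
  rw [integral_prod _ h0]
  have h1 : ∀ g ∈ Set.Ioi (0 : ℝ), ∫ t, vertexKernel 0 a (g, t) =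
      ((Real.exp (-(g / 2) - a ^ 2 / (2 * g)) / g * Real.sqrt (2 * Real.pi * g) : ℝ) : ℂ) := by
    intro g hg
    have hg : (0 : ℝ) < g := hg
    have : ∀ t : ℝ, vertexKernel 0 a (g, t) =
        ((Real.exp (-(g / 2) - a ^ 2 / (2 * g)) / g * Real.exp (-(1 / (2 * g)) * t ^ 2) : ℝ) : ℂ) := by
      intro t
      simp only [vertexKernel, pow_zero, one_mul]
      congr 1
      rw [div_mul_eq_mul_div, ← Real.exp_add]
      congr 2
      ring
    simp only [this]
    rw [integral_complex_ofReal, integral_const_mul, integral_gaussian]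
    congr 3
    field_simp
  rw [setIntegral_congr_fun measurableSet_Ioi h1, integral_complex_ofReal]
  congr 1
  have hd : ∀ r ∈ Set.Ioi (0 : ℝ), HasDerivWithinAt (fun r : ℝ => r ^ 2) (2 * r)
      (Set.Ioi 0) r := by
    intro r hr
    simpa using (hasDerivAt_pow 2 r).hasDerivWithinAt (s := Set.Ioi 0)
  have him : (fun r : ℝ => r ^ 2) '' Set.Ioi 0 = Set.Ioi 0 := by
    ext x
    constructor
    · rintro ⟨r, hr, rfl⟩
      exact pow_pos (Set.mem_Ioi.1 hr) 2
    · intro hx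
      exact ⟨Real.sqrt x, Real.sqrt_pos.2 hx, Real.sq_sqrt (le_of_lt hx)⟩
  have hinj : Set.InjOn (fun r : ℝ => r ^ 2) (Set.Ioi 0) := by
    intro x hx y hy h
    exact (pow_left_inj₀ (le_of_lt hx) (le_of_lt hy) two_ne_zero).1 h
  have h2 := integral_image_eq_integral_abs_deriv_smul measurableSet_Ioi hd hinj
    (fun g => Real.exp (-(g / 2) - a ^ 2 / (2 * g)) / g * Real.sqrt (2 * Real.pi * g))
  rw [him] at h2
  rw [h2]
  have h3 : ∀ r ∈ Set.Ioi (0 : ℝ), |2 * r| • (Real.exp (-(r ^ 2 / 2) - a ^ 2 / (2 * r ^ 2)) / r ^ 2 *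
      Real.sqrt (2 * Real.pi * r ^ 2)) =
      2 * Real.sqrt (2 * Real.pi) * Real.exp (-a) * Real.exp (-(1 / 2) * (r - a / r) ^ 2) := by
    intro r hr
    have hr : (0 : ℝ) < r := hr
    rw [abs_of_pos (by positivity), Real.sqrt_mul (by positivity), Real.sqrt_sq hr.le,
      mul_assoc _ (Real.exp (-a)), ← Real.exp_add,
      show -a + -(1 / 2) * (r - a / r) ^ 2 = -(r ^ 2 / 2) - a ^ 2 / (2 * r ^ 2) by field_simp; ring,
      smul_eq_mul]
    field_simp
  rw [setIntegral_congr_fun measurableSet_Ioi h3, integral_const_mul,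
    (integral_exp_sq_sub_div ha).1]
  have := Real.mul_self_sqrt (show 0 ≤ 2 * Real.pi by positivity)
  linear_combination (Real.exp (-a)) * this

/-- All holomorphic moments of the complex field `(a + i t) / g` of a single vertex are equal to
the total mass, so that they are `1` after normalization. -/
theorem integral_vertexKernel (m : ℕ) : ∀ {a : ℝ}, 0 < a →
    ∫ x, vertexKernel m a x ∂vertexMeasure = ((2 * Real.pi * Real.exp (-a) : ℝ) : ℂ) := by
  induction m with
  | zero => exact integral_vertexKernel_zero
  | succ m ih =>
    intro a ha
    have h1 := hasDerivAt_integral_vertexKernel m ha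
    have h2 : HasDerivAt (fun a : ℝ => ((2 * Real.pi * Real.exp (-a) : ℝ) : ℂ))
        (((2 * Real.pi * (Real.exp (-a) * -1) : ℝ)) : ℂ) a :=
      (((hasDerivAt_neg a).exp).const_mul (2 * Real.pi)).ofReal_comp
    have h3 := h1.unique (h2.congr_of_eventuallyEq
      (by filter_upwards [Ioi_mem_nhds ha] with b hb using ih hb))
    rw [← neg_inj, h3]
    push_cast
    ring

/-! ### Linear algebra of finite networks -/

/-- Finite networks pinned at `none`: the weights are symmetric, nonnegative, vanish on the
diagonal, and every nonempty set of unpinned vertices is left by an edge of positive weight, which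
says that the graph of the positive weights is connected. -/
structure IsNetwork {ι : Type*} (W : Option ι → Option ι → ℝ) : Prop where
  symm : ∀ i j, W i j = W j i
  nonneg : ∀ i j, 0 ≤ W i j
  diag : ∀ i, W i i = 0
  exit : ∀ Z : Set ι, Z.Nonempty → ∃ i ∈ Z, ∃ j : Option ι, (∀ z ∈ Z, j ≠ some z) ∧
    0 < W (some i) j

/-- The weights of the edges to the pinned vertex. -/
def etaV {ι : Type*} (W : Option ι → Option ι → ℝ) : ι → ℝ := fun j => W (some j) none

section LinearAlgebra

theorem isHermitian_matH {ι : Type*} [DecidableEq ι] {W : Option ι → Option ι → ℝ}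
    (hsymm : ∀ i j, W i j = W j i) (β : ι → ℝ) :
    (matH W β).IsHermitian := by
  ext i j
  simp only [Matrix.conjTranspose_apply, matH, Matrix.sub_apply, Matrix.of_apply, star_trivial,
    hsymm (some i) (some j)]
  by_cases h : i = j
  · subst h; rfl
  · simp [h, Ne.symm h]

variable {ι : Type*} [Fintype ι] [DecidableEq ι] {W : Option ι → Option ι → ℝ}

/-- The Dirichlet form with conductances `W_{ij} e^{u_i + u_j}`. -/
theorem dotProduct_matAV_mulVec (hsymm : ∀ i j, W i j = W j i) (hdiag : ∀ i, W i i = 0)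
    (u : Option ι → ℝ) (v : ι → ℝ) :
    v ⬝ᵥ (matAV W u).mulVec v =
      1 / 2 * ∑ i, ∑ j, W i j * Real.exp (u i + u j) * (pin v i - pin v j) ^ 2 := by
  have h0 : v ⬝ᵥ (matAV W u).mulVec v =
      ∑ i, ∑ j, W i j * Real.exp (u i + u j) * (pin v i - pin v j) * pin v i := by
    rw [Fintype.sum_option]
    simp only [dotProduct, matAV_mulVec W hdiag u v, pin, mul_zero, Finset.sum_const_zero, zero_add]
    refine Finset.sum_congr rfl fun i _ => ?_
    rw [mul_comm, Finset.sum_mul]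
  have h1 : v ⬝ᵥ (matAV W u).mulVec v =
      -∑ i, ∑ j, W i j * Real.exp (u i + u j) * (pin v i - pin v j) * pin v j := by
    rw [h0, Finset.sum_comm]
    simp only [← Finset.sum_neg_distrib]
    refine Finset.sum_congr rfl fun i _ => Finset.sum_congr rfl fun j _ => ?_
    rw [hsymm j i, add_comm (u j)]
    ring
  have h2 : ∑ i, ∑ j, W i j * Real.exp (u i + u j) * (pin v i - pin v j) ^ 2 =
      ∑ i, ∑ j, W i j * Real.exp (u i + u j) * (pin v i - pin v j) * pin v i -
      ∑ i, ∑ j, W i j * Real.exp (u i + u j) * (pin v i - pin v j) * pin v j := by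
    simp only [← Finset.sum_sub_distrib]
    refine Finset.sum_congr rfl fun i _ => Finset.sum_congr rfl fun j _ => ?_
    ring
  linarith

theorem pin_dotProduct_matA_mulVec (u : Option ι → ℝ) (v : ι → ℝ) :
    pin v ⬝ᵥ (matA W u).mulVec (pin v) = v ⬝ᵥ (matAV W u).mulVec v := by
  simp [dotProduct, Matrix.mulVec, Fintype.sum_option, pin, matAV]

theorem isHermitian_matAV (hsymm : ∀ i j, W i j = W j i) (u : Option ι → ℝ) :
    (matAV W u).IsHermitian := by
  ext i j
  simp only [Matrix.conjTranspose_apply, matAV, Matrix.submatrix_apply, matA, Matrix.of_apply,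
    star_trivial, hsymm (some i) (some j), add_comm (u (some i)) (u (some j))]
  by_cases h : i = j
  · subst h; rfl
  · simp [h, Ne.symm h]

theorem posDef_matAV (hW : IsNetwork W) (u : Option ι → ℝ) : (matAV W u).PosDef := by
  refine Matrix.PosDef.of_dotProduct_mulVec_pos (isHermitian_matAV hW.symm u) fun v hv => ?_
  rw [star_trivial, dotProduct_matAV_mulVec hW.symm hW.diag]
  obtain ⟨i, hi, j, hj, hij⟩ := hW.exit {i | v i ≠ 0} (Function.ne_iff.1 hv)
  have hnn : ∀ i j, 0 ≤ W i j * Real.exp (u i + u j) * (pin v i - pin v j) ^ 2 := fun i j =>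
    mul_nonneg (mul_nonneg (hW.nonneg i j) (Real.exp_pos _).le) (sq_nonneg _)
  have hj0 : pin v j = 0 := by
    cases j with
    | none => rfl
    | some j =>
      by_contra h
      exact hj j h rfl
  have h1 : 0 < W (some i) j * Real.exp (u (some i) + u j) * (pin v (some i) - pin v j) ^ 2 := by
    rw [hj0, sub_zero]
    exact mul_pos (mul_pos hij (Real.exp_pos _)) (sq_pos_of_ne_zero hi)
  have h2 := Finset.single_le_sum (f := fun j => W (some i) j * Real.exp (u (some i) + u j) *
    (pin v (some i) - pin v j) ^ 2) (fun j _ => hnn (some i) j) (Finset.mem_univ j)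
  have h3 := Finset.single_le_sum (f := fun i => ∑ j, W i j * Real.exp (u i + u j) *
    (pin v i - pin v j) ^ 2) (fun i _ => Finset.sum_nonneg fun j _ => hnn i j)
    (Finset.mem_univ (some i))
  linarith

/-- Coercivity of the Dirichlet form on vectors pinned at `δ`, by compactness of the unit sphere. -/
theorem exists_mul_sum_sq_le (hW : IsNetwork W) : ∃ c > 0, ∀ v : ι → ℝ,
    c * ∑ i, v i ^ 2 ≤ 1 / 2 * ∑ i, ∑ j, W i j * (pin v i - pin v j) ^ 2 := by
  have hA := posDef_matAV hW 0
  have hE : ∀ v : ι → ℝ, 1 / 2 * ∑ i, ∑ j, W i j * (pin v i - pin v j) ^ 2 =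
      v ⬝ᵥ (matAV W 0).mulVec v := by
    intro v
    rw [dotProduct_matAV_mulVec hW.symm hW.diag]
    simp
  simp only [hE]
  cases isEmpty_or_nonempty ι with
  | inl h => exact ⟨1, one_pos, fun v => by simp⟩
  | inr h =>
    set S : Set (ι → ℝ) := {v | ∑ i, v i ^ 2 = 1} with hS
    have hSc : IsCompact S := by
      refine Metric.isCompact_of_isClosed_isBounded
        (isClosed_eq (by fun_prop) continuous_const) ?_
      refine (Metric.isBounded_closedBall (x := (0 : ι → ℝ)) (r := 1)).subset fun v hv => ?_
      rw [mem_closedBall_zero_iff, pi_norm_le_iff_of_nonneg zero_le_one]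
      intro i
      have := Finset.single_le_sum (f := fun i => v i ^ 2) (fun i _ => sq_nonneg _)
        (Finset.mem_univ i)
      simp only [hS, Set.mem_ofPred_eq] at hv
      rw [Real.norm_eq_abs, ← sq_le_one_iff_abs_le_one]
      exact this.trans hv.le
    have hSn : S.Nonempty := by
      obtain ⟨i⟩ := h
      exact ⟨Pi.single i 1, by simp [hS, Pi.single_apply]⟩
    have hcont : Continuous fun v : ι → ℝ => v ⬝ᵥ (matAV W 0).mulVec v := by
      simp only [dotProduct, Matrix.mulVec]
      fun_prop
    obtain ⟨v₀, hv₀, hmin⟩ := hSc.exists_isMinOn hSn hcont.continuousOn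
    refine ⟨v₀ ⬝ᵥ (matAV W 0).mulVec v₀, ?_, fun v => ?_⟩
    · have h0 : v₀ ≠ 0 := by
        rintro rfl
        simp [hS] at hv₀
      simpa using hA.dotProduct_mulVec_pos h0
    · by_cases hv : v = 0
      · subst hv; simp
      set R := ∑ i, v i ^ 2 with hR
      have hR0 : 0 < R := by
        obtain ⟨i, hi⟩ := Function.ne_iff.1 hv
        exact Finset.sum_pos' (fun i _ => sq_nonneg _) ⟨i, Finset.mem_univ i, by
          have : v i ≠ 0 := hi
          positivity⟩
      have hs := Real.sqrt_pos.2 hR0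
      have hsq := Real.mul_self_sqrt hR0.le
      have hmem : (Real.sqrt R)⁻¹ • v ∈ S := by
        simp only [hS, Set.mem_ofPred_eq, Pi.smul_apply, smul_eq_mul, mul_pow, ← Finset.mul_sum,
          ← hR]
        rw [inv_pow, Real.sq_sqrt hR0.le, inv_mul_cancel₀ hR0.ne']
      have h1 := hmin hmem
      simp only [Set.mem_ofPred_eq, Matrix.mulVec_smul, dotProduct_smul, smul_dotProduct,
        smul_eq_mul] at h1
      rw [← mul_assoc, ← mul_inv, hsq, inv_mul_eq_div, le_div_iff₀ hR0] at h1
      exact h1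

theorem matH_betaV (hdiag : ∀ i, W i i = 0) (u : ι → ℝ) :
    matH W (betaV W (pin u)) = Matrix.diagonal (fun i => Real.exp (-u i)) * matAV W (pin u) *
      Matrix.diagonal (fun i => Real.exp (-u i)) := by
  ext i j
  rw [Matrix.mul_diagonal, Matrix.diagonal_mul]
  by_cases h : i = j
  · subst h
    simp only [matH, betaV, matAV, matA, pin, Matrix.sub_apply, Matrix.diagonal_apply_eq,
      Matrix.of_apply, hdiag, Matrix.submatrix_apply, if_true, Finset.mul_sum, Finset.sum_mul,
      sub_zero]
    refine Finset.sum_congr rfl fun k _ => ?_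
    rw [Real.exp_add, Real.exp_sub, Real.exp_neg]
    field_simp
  · simp only [matH, matAV, matA, pin, Matrix.sub_apply, Matrix.diagonal_apply_ne _ h,
      Matrix.of_apply, Matrix.submatrix_apply, Option.some.injEq, h, if_false, zero_sub]
    rw [Real.exp_add, Real.exp_neg, Real.exp_neg]
    field_simp

theorem posDef_matH_betaV (hW : IsNetwork W) (u : ι → ℝ) :
    (matH W (betaV W (pin u))).PosDef := by
  have hA := posDef_matAV hW (pin u)
  have hinj : Function.Injective (Matrix.diagonal fun i => Real.exp (-u i)).mulVec := by
    intro v w h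
    funext i
    have := congrFun h i
    rw [Matrix.mulVec_diagonal, Matrix.mulVec_diagonal] at this
    exact mul_left_cancel₀ (Real.exp_pos _).ne' this
  have h := hA.conjTranspose_mul_mul_same hinj
  rw [Matrix.diagonal_conjTranspose, star_trivial] at h
  rwa [matH_betaV hW.diag]

/-- The equation `H_{β(u)} e^u = η`, by which `β` determines `u`. -/
theorem matH_betaV_mulVec_exp (u : ι → ℝ) :
    (matH W (betaV W (pin u))).mulVec (fun i => Real.exp (u i)) = etaV W := by
  funext i
  simp only [matH, Matrix.sub_mulVec, Pi.sub_apply, Matrix.mulVec_diagonal]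
  simp only [betaV, Matrix.mulVec, dotProduct, Matrix.of_apply, etaV]
  rw [Fintype.sum_option]
  simp only [pin, mul_add, add_mul, Finset.mul_sum, Finset.sum_mul, Real.exp_sub, Real.exp_zero]
  have : ∀ j, 2 * (1 / 2 * (W (some i) (some j) * (Real.exp (u j) / Real.exp (u i)))) *
      Real.exp (u i) = W (some i) (some j) * Real.exp (u j) := by
    intro j
    field_simp
  simp only [this]
  field_simp
  ring

theorem isUnit_det_of_posDef {H : Matrix ι ι ℝ} (hH : H.PosDef) : IsUnit H.det :=
  isUnit_iff_ne_zero.2 hH.det_pos.ne'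

theorem inv_mulVec_eq_of_mulVec_eq {H : Matrix ι ι ℝ} (hH : H.PosDef) {v w : ι → ℝ}
    (h : H.mulVec v = w) : H⁻¹.mulVec w = v := by
  rw [← h, Matrix.mulVec_mulVec, Matrix.nonsing_inv_mul _ (isUnit_det_of_posDef hH),
    Matrix.one_mulVec]

theorem mulVec_inv_mulVec {H : Matrix ι ι ℝ} (hH : H.PosDef) (w : ι → ℝ) :
    H.mulVec (H⁻¹.mulVec w) = w := by
  rw [Matrix.mulVec_mulVec, Matrix.mul_nonsing_inv _ (isUnit_det_of_posDef hH), Matrix.one_mulVec]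

theorem matH_mulVec (β v : ι → ℝ) (i : ι) :
    (matH W β).mulVec v i = 2 * β i * v i - ∑ j, W (some i) (some j) * v j := by
  rw [matH, Matrix.sub_mulVec, Pi.sub_apply, Matrix.mulVec_diagonal]
  rfl

/-- Maximum principle: a positive definite matrix with nonpositive off-diagonal entries has an
entrywise nonnegative inverse, and connectivity makes the solution with right-hand side `η`
strictly positive. -/
theorem inv_matH_mulVec_etaV_pos (hW : IsNetwork W) {β : ι → ℝ} (hβ : (matH W β).PosDef) (i : ι) :
    0 < (matH W β)⁻¹.mulVec (etaV W) i := by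
  set v := (matH W β)⁻¹.mulVec (etaV W) with hv
  have hHv : (matH W β).mulVec v = etaV W := mulVec_inv_mulVec hβ _
  have heta : ∀ i, 0 ≤ etaV W i := fun i => hW.nonneg _ _
  have hnn : ∀ i, 0 ≤ v i := by
    -- `w` is the negative part of `v`; testing `H v = η ≥ 0` with `w` gives `⟨w, H w⟩ ≤ 0`
    set w : ι → ℝ := fun i => max (-v i) 0 with hw
    have hw0 : ∀ i, 0 ≤ w i := fun i => le_max_right _ _
    have hvw : ∀ i, 0 ≤ v i + w i := fun i => by
      have := le_max_left (-v i) 0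
      simp only [hw]; linarith
    have hww : ∀ i, (v i + w i) * w i = 0 := by
      intro i
      simp only [hw]
      rcases le_total (-v i) 0 with h | h
      · rw [max_eq_right h, mul_zero]
      · rw [max_eq_left h, add_neg_cancel, zero_mul]
    have hq : w ⬝ᵥ (matH W β).mulVec w ≤ 0 := by
      have h1 : w ⬝ᵥ (matH W β).mulVec (v + w) ≤ 0 := by
        simp only [dotProduct, matH_mulVec, Pi.add_apply]
        refine Finset.sum_nonpos fun i _ => ?_
        have h2 : 0 ≤ w i * ∑ j, W (some i) (some j) * (v j + w j) :=
          mul_nonneg (hw0 i) (Finset.sum_nonneg fun j _ => mul_nonneg (hW.nonneg _ _) (hvw j))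
        linear_combination h2 + 2 * β i * hww i
      have h2 : 0 ≤ w ⬝ᵥ (matH W β).mulVec v := by
        rw [hHv]
        exact Finset.sum_nonneg fun i _ => mul_nonneg (hw0 i) (heta i)
      rw [Matrix.mulVec_add, dotProduct_add] at h1
      linarith
    have hw00 : w = 0 := by
      by_contra h
      have := hβ.dotProduct_mulVec_pos h
      rw [star_trivial] at this
      linarith
    intro i
    have := hvw i
    rw [hw00] at this
    simpa using this
  -- the zero set of `v` cannot have an exit
  by_contra hi
  have hi : v i = 0 := le_antisymm (not_lt.1 hi) (hnn i)
  obtain ⟨i, hi, j, hj, hij⟩ := hW.exit {i | v i = 0} ⟨i, hi⟩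
  have hi : v i = 0 := hi
  have h1 := congrFun hHv i
  rw [matH_mulVec, hi, mul_zero, zero_sub] at h1
  have h2 : 0 ≤ ∑ j, W (some i) (some j) * v j :=
    Finset.sum_nonneg fun j _ => mul_nonneg (hW.nonneg _ _) (hnn j)
  cases j with
  | none =>
    have : 0 < etaV W i := hij
    linarith
  | some j =>
    have hvj : 0 < v j := lt_of_le_of_ne (hnn j) fun h => hj j h.symm rfl
    have h3 := Finset.single_le_sum (f := fun j => W (some i) (some j) * v j)
      (fun j _ => mul_nonneg (hW.nonneg _ _) (hnn j)) (Finset.mem_univ j)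
    have h4 := mul_pos hij hvj
    have := heta i
    linarith

/-- The range of `u ↦ β(u)` is the set where `H_β` is positive definite. -/
theorem range_betaV (hW : IsNetwork W) :
    Set.range (fun u : ι → ℝ => betaV W (pin u)) = {β | (matH W β).PosDef} := by
  ext β
  constructor
  · rintro ⟨u, rfl⟩
    exact posDef_matH_betaV hW u
  · intro hβ
    have hβ : (matH W β).PosDef := hβ
    set v := (matH W β)⁻¹.mulVec (etaV W) with hv
    have hvp : ∀ i, 0 < v i := inv_matH_mulVec_etaV_pos hW hβ
    refine ⟨fun i => Real.log (v i), funext fun i => ?_⟩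
    have h1 := congrFun (mulVec_inv_mulVec hβ (etaV W)) i
    rw [← hv, matH_mulVec] at h1
    simp only [betaV, Fintype.sum_option, pin, Real.exp_sub, Real.exp_log (hvp _), Real.exp_zero]
    simp only [mul_div_assoc', mul_one, ← Finset.sum_div]
    rw [← add_div, mul_div_assoc', div_eq_iff (hvp i).ne']
    simp only [etaV] at h1
    linarith

theorem injective_betaV (hW : IsNetwork W) :
    Function.Injective fun u : ι → ℝ => betaV W (pin u) := by
  intro u u' h
  simp only at h
  have h1 := inv_mulVec_eq_of_mulVec_eq (posDef_matH_betaV hW u) (matH_betaV_mulVec_exp u)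
  have h2 := inv_mulVec_eq_of_mulVec_eq (posDef_matH_betaV hW u') (matH_betaV_mulVec_exp u')
  rw [h, h2] at h1
  funext i
  exact (Real.exp_injective (congrFun h1 i)).symm

theorem exp_uOfBeta (hW : IsNetwork W) {β : ι → ℝ} (hβ : (matH W β).PosDef) (i : ι) :
    Real.exp (uOfBeta W β (some i)) = (matH W β)⁻¹.mulVec (etaV W) i :=
  Real.exp_log (inv_matH_mulVec_etaV_pos hW hβ i)

theorem exp_mul_sOfBetaTheta (hW : IsNetwork W) {β : ι → ℝ} (hβ : (matH W β).PosDef)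
    (θ : ι → ℝ) (i : ι) :
    Real.exp (uOfBeta W β (some i)) * sOfBetaTheta W β θ (some i) =
      (matH W β)⁻¹.mulVec θ i := by
  obtain ⟨u, rfl⟩ : β ∈ Set.range fun u : ι → ℝ => betaV W (pin u) := by
    rw [range_betaV hW]; exact hβ
  have hu : uOfBeta W (betaV W (pin u)) = pin u := by
    have h1 := inv_mulVec_eq_of_mulVec_eq (posDef_matH_betaV hW u) (matH_betaV_mulVec_exp u)
    unfold etaV at h1
    unfold uOfBeta
    rw [h1]
    simp
  have hA := posDef_matAV hW (pin u)
  have h2 : (matH W (betaV W (pin u))).mulVec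
      (fun i => Real.exp (u i) * sOfBetaTheta W (betaV W (pin u)) θ (some i)) = θ := by
    have e1 : (Matrix.diagonal fun i => Real.exp (-u i)).mulVec
        (fun i => Real.exp (u i) * sOfBetaTheta W (betaV W (pin u)) θ (some i)) =
        (matAV W (pin u))⁻¹.mulVec ((Matrix.diagonal fun i => Real.exp (u i)).mulVec θ) := by
      funext i
      rw [Matrix.mulVec_diagonal, ← mul_assoc, ← Real.exp_add, neg_add_cancel, Real.exp_zero,
        one_mul]
      unfold sOfBetaTheta
      rw [hu]
      rfl
    rw [matH_betaV hW.diag, ← Matrix.mulVec_mulVec, e1, ← Matrix.mulVec_mulVec,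
      mulVec_inv_mulVec hA]
    funext i
    rw [Matrix.mulVec_diagonal, Matrix.mulVec_diagonal, ← mul_assoc, ← Real.exp_add,
      neg_add_cancel, Real.exp_zero, one_mul]
  rw [inv_mulVec_eq_of_mulVec_eq hβ h2, hu]
  rfl

end LinearAlgebra

/-! ### The law of `(β, θ)` -/

section ChangeOfVariables

theorem measurable_matH_apply {ι : Type*} [DecidableEq ι] (W : Option ι → Option ι → ℝ)
    (i j : ι) : Measurable fun β : ι → ℝ => matH W β i j := by
  by_cases h : i = j
  · subst h
    simp only [matH, Matrix.sub_apply, Matrix.diagonal_apply_eq, Matrix.of_apply]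
    fun_prop
  · simp only [matH, Matrix.sub_apply, Matrix.diagonal_apply_ne _ h]
    fun_prop

theorem continuous_pin_apply {ι : Type*} (j : Option ι) :
    Continuous fun u : ι → ℝ => pin u j := by
  cases j with
  | none => exact continuous_const
  | some j => exact continuous_apply j

theorem continuous_betaV {ι : Type*} [Fintype ι] (W : Option ι → Option ι → ℝ) :
    Continuous fun u : ι → ℝ => betaV W (pin u) := by
  have h := continuous_pin_apply (ι := ι)
  unfold betaV
  fun_prop

variable {ι : Type*} [Fintype ι] [DecidableEq ι] {W : Option ι → Option ι → ℝ}

/-- The Lebesgue density of the law of `(β, θ)`, on the set where `H_β` is positive definite. -/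
def nuDensity (W : Option ι → Option ι → ℝ) (x : (ι → ℝ) × (ι → ℝ)) : ℝ :=
  Real.exp (-(1 / 2) * ∑ i, ∑ j, matH W x.1 i j + ∑ i, etaV W i -
      1 / 2 * (etaV W ⬝ᵥ (matH W x.1)⁻¹.mulVec (etaV W)) -
      1 / 2 * (x.2 ⬝ᵥ (matH W x.1)⁻¹.mulVec x.2)) /
    (Real.pi ^ Fintype.card ι * (matH W x.1).det)

/-- The law of `(β, θ)`, as a measure with a density with respect to Lebesgue measure. -/
def nu (W : Option ι → Option ι → ℝ) : Measure ((ι → ℝ) × (ι → ℝ)) :=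
  volume.withDensity ({x | (matH W x.1).PosDef}.indicator fun x => ENNReal.ofReal (nuDensity W x))

theorem measurable_det {α : Type*} [MeasurableSpace α] (M : α → Matrix ι ι ℝ)
    (hM : ∀ i j, Measurable fun a => M a i j) : Measurable fun a => (M a).det := by
  simp only [Matrix.det_apply']
  exact Finset.measurable_sum _ fun σ _ =>
    (Finset.measurable_prod _ fun k _ => hM _ _).const_mul _

theorem measurable_inv_matH_apply (W : Option ι → Option ι → ℝ) (i j : ι) :
    Measurable fun β : ι → ℝ => (matH W β)⁻¹ i j :=
  measurable_inv_apply _ (measurable_matH_apply W) i j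

theorem measurable_inv_matH_mulVec (W : Option ι → Option ι → ℝ) (i : ι) :
    Measurable fun x : (ι → ℝ) × (ι → ℝ) => (matH W x.1)⁻¹.mulVec x.2 i :=
  Finset.measurable_sum _ fun j _ => ((measurable_inv_matH_apply W i j).comp measurable_fst).mul
    ((measurable_pi_apply j).comp measurable_snd)

theorem measurable_inv_matH_mulVec_const (W : Option ι → Option ι → ℝ) (η : ι → ℝ) (i : ι) :
    Measurable fun x : (ι → ℝ) × (ι → ℝ) => (matH W x.1)⁻¹.mulVec η i :=
  (measurable_inv_matH_mulVec W i).comp (measurable_fst.prodMk measurable_const)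

theorem measurable_nuDensity (W : Option ι → Option ι → ℝ) : Measurable (nuDensity W) := by
  have h1 : Measurable fun x : (ι → ℝ) × (ι → ℝ) => (matH W x.1).det :=
    (measurable_det _ (measurable_matH_apply W)).comp measurable_fst
  have h2 : Measurable fun x : (ι → ℝ) × (ι → ℝ) => ∑ i, ∑ j, matH W x.1 i j :=
    Finset.measurable_sum _ fun i _ => Finset.measurable_sum _ fun j _ =>
      (measurable_matH_apply W i j).comp measurable_fst
  have h3 : Measurable fun x : (ι → ℝ) × (ι → ℝ) =>
      etaV W ⬝ᵥ (matH W x.1)⁻¹.mulVec (etaV W) :=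
    Finset.measurable_sum _ fun i _ => (measurable_inv_matH_mulVec_const W (etaV W) i).const_mul _
  have h4 : Measurable fun x : (ι → ℝ) × (ι → ℝ) => x.2 ⬝ᵥ (matH W x.1)⁻¹.mulVec x.2 :=
    Finset.measurable_sum _ fun i _ =>
      ((measurable_pi_apply i).comp measurable_snd).mul (measurable_inv_matH_mulVec W i)
  exact ((((h2.const_mul _).add_const _).sub (h3.const_mul _)).sub (h4.const_mul _)).exp.div
    (h1.const_mul _)

theorem measurableSet_posDef_matH (hW : IsNetwork W) :
    MeasurableSet {β : ι → ℝ | (matH W β).PosDef} := by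
  rw [← range_betaV hW]
  exact ((continuous_betaV W).measurableEmbedding (injective_betaV hW)).measurableSet_range

/-- The Jacobian matrix of `u ↦ β(u)` is `-½ diag(e^{-2u}) A_{VV}(u)`. -/
def jacBeta (W : Option ι → Option ι → ℝ) (u : ι → ℝ) : Matrix ι ι ℝ :=
  Matrix.diagonal (fun i => -(1 / 2) * Real.exp (-(2 * u i))) * matAV W (pin u)

theorem hasFDerivAt_betaV (hdiag : ∀ i, W i i = 0) (u : ι → ℝ) :
    HasFDerivAt (fun u : ι → ℝ => betaV W (pin u))
      (LinearMap.toContinuousLinearMap (Matrix.toLin' (jacBeta W u))) u := by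
  rw [hasFDerivAt_pi']
  intro i
  let p : Option ι → ((ι → ℝ) →L[ℝ] ℝ) := fun j =>
    match j with
    | none => 0
    | some j => ContinuousLinearMap.proj j
  have hp : ∀ j, HasFDerivAt (fun u : ι → ℝ => pin u j) (p j) u := by
    intro j
    cases j with
    | none => exact hasFDerivAt_const _ _
    | some j => exact (ContinuousLinearMap.proj (R := ℝ) (φ := fun _ : ι => ℝ) j).hasFDerivAt
  have hpv : ∀ j v, p j v = pin v j := by
    intro j v
    cases j <;> rfl
  have h1 : HasFDerivAt (fun u : ι → ℝ => betaV W (pin u) i)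
      ((1 / 2 : ℝ) • ∑ j, W (some i) j • (Real.exp (pin u j - pin u (some i)) •
        (p j - p (some i)))) u := by
    unfold betaV
    refine HasFDerivAt.const_mul (HasFDerivAt.fun_sum fun j _ => ?_) _
    exact (((hp j).sub (hp (some i))).exp).const_mul _
  refine h1.congr_fderiv ?_
  ext v
  simp only [ContinuousLinearMap.comp_apply, smul_apply,
    sum_apply, sub_apply, hpv,
    ContinuousLinearMap.proj_apply, LinearMap.coe_toContinuousLinearMap', Matrix.toLin'_apply,
    smul_eq_mul]
  rw [jacBeta, ← Matrix.mulVec_mulVec, Matrix.mulVec_diagonal, matAV_mulVec W hdiag, Finset.mul_sum,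
    Finset.mul_sum]
  refine Finset.sum_congr rfl fun j _ => ?_
  have : Real.exp (pin u j - pin u (some i)) =
      Real.exp (-(2 * u i)) * Real.exp (pin u (some i) + pin u j) := by
    rw [← Real.exp_add]
    congr 1
    simp only [pin]
    ring
  rw [this]
  simp only [pin]
  ring

theorem det_matH_betaV (hdiag : ∀ i, W i i = 0) (u : ι → ℝ) :
    (matH W (betaV W (pin u))).det =
      (∏ i, Real.exp (-u i)) * ((∏ i, Real.exp (-u i)) * (matAV W (pin u)).det) := by
  rw [matH_betaV hdiag, Matrix.det_mul, Matrix.det_mul, Matrix.det_diagonal]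
  ring

theorem det_jacBeta (hdiag : ∀ i, W i i = 0) (u : ι → ℝ) :
    (jacBeta W u).det = (-(1 / 2)) ^ Fintype.card ι * (matH W (betaV W (pin u))).det := by
  have h : ∏ i, Real.exp (-(2 * u i)) = (∏ i, Real.exp (-u i)) * ∏ i, Real.exp (-u i) := by
    rw [← Finset.prod_mul_distrib]
    refine Finset.prod_congr rfl fun i _ => ?_
    rw [← Real.exp_add]
    congr 1
    ring
  rw [jacBeta, Matrix.det_mul, Matrix.det_diagonal, Finset.prod_mul_distrib, det_matH_betaV hdiag,
    Finset.prod_const, Finset.card_univ, h]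
  ring

/-- The matrix of the linear map `s ↦ θ(u, s)`. -/
def matB (W : Option ι → Option ι → ℝ) (u : ι → ℝ) : Matrix ι ι ℝ :=
  Matrix.diagonal (fun i => Real.exp (-u i)) * matAV W (pin u)

theorem thetaV_eq (u s : ι → ℝ) : thetaV W (pin u) (pin s) = (matB W u).mulVec s := by
  rw [matB, ← Matrix.mulVec_mulVec]
  rfl

theorem det_matB (u : ι → ℝ) :
    (matB W u).det = (∏ i, Real.exp (-u i)) * (matAV W (pin u)).det := by
  rw [matB, Matrix.det_mul, Matrix.det_diagonal]

theorem dotProduct_inv_matH_thetaV (hW : IsNetwork W) (u s : ι → ℝ) :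
    (matB W u).mulVec s ⬝ᵥ (matH W (betaV W (pin u)))⁻¹.mulVec ((matB W u).mulVec s) =
      s ⬝ᵥ (matAV W (pin u)).mulVec s := by
  have h : (matH W (betaV W (pin u))).mulVec (fun i => Real.exp (u i) * s i) =
      (matB W u).mulVec s := by
    rw [matH_betaV hW.diag, matB, ← Matrix.mulVec_mulVec]
    congr 1
    funext i
    rw [Matrix.mulVec_diagonal, ← mul_assoc, ← Real.exp_add, neg_add_cancel, Real.exp_zero, one_mul]
  rw [inv_mulVec_eq_of_mulVec_eq (posDef_matH_betaV hW u) h, matB, ← Matrix.mulVec_mulVec,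
    dotProduct, dotProduct]
  refine Finset.sum_congr rfl fun i _ => ?_
  rw [Matrix.mulVec_diagonal]
  have : Real.exp (-u i) * Real.exp (u i) = 1 := by
    rw [← Real.exp_add, neg_add_cancel, Real.exp_zero]
  linear_combination ((matAV W (pin u)).mulVec s i * s i) * this

/-- The energy `∑ W_{ij} (cosh (u_i - u_j) - 1)` in terms of `β(u)`. -/
theorem energy_eq (hW : IsNetwork W) (u : ι → ℝ) :
    -(1 / 2) * ∑ i, ∑ j, W i j * (Real.cosh (pin u i - pin u j) - 1) =
      -(1 / 2) * ∑ i, ∑ j, matH W (betaV W (pin u)) i j + ∑ i, etaV W i -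
      1 / 2 * (etaV W ⬝ᵥ (matH W (betaV W (pin u)))⁻¹.mulVec (etaV W)) := by
  rw [inv_mulVec_eq_of_mulVec_eq (posDef_matH_betaV hW u) (matH_betaV_mulVec_exp u)]
  have h1 : ∑ i, ∑ j, matH W (betaV W (pin u)) i j =
      ∑ i, ∑ j, W (some i) (some j) * Real.exp (u j - u i) + ∑ i, etaV W i * Real.exp (-u i) -
        ∑ i, ∑ j, W (some i) (some j) := by
    rw [← Finset.sum_add_distrib, ← Finset.sum_sub_distrib]
    refine Finset.sum_congr rfl fun i _ => ?_
    simp only [matH, Matrix.sub_apply, Matrix.of_apply, Finset.sum_sub_distrib,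
      Matrix.diagonal_apply, Finset.sum_ite_eq, Finset.mem_univ, if_true, betaV,
      Fintype.sum_option, pin, zero_sub, etaV]
    ring
  have h2 : ∑ i, ∑ j, W (some i) (some j) * Real.exp (u j - u i) =
      ∑ i, ∑ j, W (some i) (some j) * Real.cosh (u i - u j) := by
    have h3 : ∑ i, ∑ j, W (some i) (some j) * Real.exp (u j - u i) =
        ∑ i, ∑ j, W (some i) (some j) * Real.exp (u i - u j) := by
      rw [Finset.sum_comm]
      refine Finset.sum_congr rfl fun i _ => Finset.sum_congr rfl fun j _ => ?_
      rw [hW.symm (some j)]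
    have h4 : ∑ i, ∑ j, W (some i) (some j) * Real.cosh (u i - u j) =
        1 / 2 * (∑ i, ∑ j, W (some i) (some j) * Real.exp (u i - u j) +
          ∑ i, ∑ j, W (some i) (some j) * Real.exp (u j - u i)) := by
      simp only [← Finset.sum_add_distrib, Finset.mul_sum]
      refine Finset.sum_congr rfl fun i _ => Finset.sum_congr rfl fun j _ => ?_
      rw [Real.cosh_eq, neg_sub]
      ring
    rw [h4, ← h3]
    ring
  rw [h1, h2]
  simp only [Fintype.sum_option, pin, Real.cosh_zero, zero_sub,
    sub_zero, Real.cosh_neg, hW.symm none, dotProduct, mul_sub, Finset.sum_sub_distrib,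
    Finset.sum_add_distrib, mul_one]
  have h5 : ∑ i, W (some i) none * Real.cosh (u i) =
      1 / 2 * (∑ i, etaV W i * Real.exp (u i) + ∑ i, etaV W i * Real.exp (-u i)) := by
    simp only [← Finset.sum_add_distrib, Finset.mul_sum]
    refine Finset.sum_congr rfl fun i _ => ?_
    rw [Real.cosh_eq, etaV]
    ring
  rw [h5]
  simp only [etaV]
  ring

theorem measurable_beta_theta (W : Option ι → Option ι → ℝ) :
    Measurable fun x : (ι → ℝ) × (ι → ℝ) => (betaV W (pin x.1), thetaV W (pin x.1) (pin x.2)) := by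
  have hp : ∀ j, Measurable fun u : ι → ℝ => pin u j := fun j => (continuous_pin_apply j).measurable
  have hp1 : ∀ j, Measurable fun x : (ι → ℝ) × (ι → ℝ) => pin x.1 j := fun j =>
    (hp j).comp measurable_fst
  refine ((continuous_betaV W).measurable.comp measurable_fst).prodMk ?_
  simp only [thetaV_eq]
  refine measurable_pi_lambda _ fun i => Finset.measurable_sum _ fun j _ => ?_
  refine Measurable.mul ?_ (by fun_prop)
  simp only [matB, Matrix.diagonal_mul, matAV, matA, Matrix.submatrix_apply, Matrix.of_apply]
  split_ifs
  · fun_prop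
  · fun_prop

theorem lintegral_comp_mulVec {M : Matrix ι ι ℝ} (hM : M.det ≠ 0) {g : (ι → ℝ) → ENNReal}
    (hg : Measurable g) :
    ∫⁻ s, g (M.mulVec s) = ENNReal.ofReal |M.det⁻¹| * ∫⁻ θ, g θ := by
  have hmeas : Measurable (Matrix.toLin' M) :=
    (LinearMap.continuous_of_finiteDimensional _).measurable
  rw [← smul_eq_mul, ← lintegral_smul_measure, ← Real.map_matrix_volume_pi_eq_smul_volume_pi hM,
    lintegral_map hg hmeas]
  rfl

/-- Compensation of the densities under the change of variables `(u, s) ↦ (β, θ)`. -/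
theorem rho_eq (hW : IsNetwork W) (u s : ι → ℝ) :
    rho W (pin u) (pin s) * ∏ i, (1 / (2 * Real.pi) * Real.exp (-u i)) =
      |(jacBeta W u).det| * |(matB W u).det| *
        nuDensity W (betaV W (pin u), (matB W u).mulVec s) := by
  have hA := (posDef_matAV hW (pin u)).det_pos
  have hP : 0 < ∏ i, Real.exp (-u i) := Finset.prod_pos fun i _ => Real.exp_pos _
  have hH := (posDef_matH_betaV hW u).det_pos
  have h1 : |(jacBeta W u).det| =
      (1 / 2) ^ Fintype.card ι * (matH W (betaV W (pin u))).det := by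
    rw [det_jacBeta hW.diag, abs_mul, abs_pow, abs_neg, abs_of_pos hH,
      abs_of_pos (by norm_num : (0 : ℝ) < 1 / 2)]
  rw [h1, det_matB, abs_of_pos (mul_pos hP hA), nuDensity, dotProduct_inv_matH_thetaV hW,
    ← energy_eq hW, rho, pin_dotProduct_matA_mulVec, sub_eq_add_neg _ (1 / 2 * _),
    Real.exp_add, Finset.prod_mul_distrib, Finset.prod_const, Finset.card_univ]
  rw [← neg_mul, show (1 / (2 * Real.pi)) ^ Fintype.card ι =
    (1 / 2) ^ Fintype.card ι / Real.pi ^ Fintype.card ι by rw [← div_pow]; congr 1; field_simp]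
  field_simp

theorem measurable_rho_mul (W : Option ι → Option ι → ℝ) :
    Measurable fun x : (ι → ℝ) × (ι → ℝ) =>
      rho W (pin x.1) (pin x.2) * ∏ i, (1 / (2 * Real.pi) * Real.exp (-x.1 i)) := by
  have hp : ∀ j, Continuous fun x : (ι → ℝ) × (ι → ℝ) => pin x.1 j := fun j =>
    (continuous_pin_apply j).comp continuous_fst
  have hA : ∀ i j, Continuous fun x : (ι → ℝ) × (ι → ℝ) => matAV W (pin x.1) i j := by
    intro i j
    simp only [matAV, matA, Matrix.submatrix_apply, Matrix.of_apply]
    split_ifs <;> fun_prop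
  have hdet : Continuous fun x : (ι → ℝ) × (ι → ℝ) => (matAV W (pin x.1)).det :=
    Continuous.matrix_det (continuous_matrix hA)
  have hq : Continuous fun x : (ι → ℝ) × (ι → ℝ) => x.2 ⬝ᵥ (matAV W (pin x.1)).mulVec x.2 := by
    simp only [dotProduct, Matrix.mulVec]
    fun_prop
  have he : Continuous fun x : (ι → ℝ) × (ι → ℝ) =>
      ∑ i, ∑ j, W i j * (Real.cosh (pin x.1 i - pin x.1 j) - 1) := by
    have := Real.continuous_cosh
    fun_prop
  simp only [rho, pin_dotProduct_matA_mulVec]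
  exact Continuous.measurable (by fun_prop)

/-- The law of `(β, θ)` under `μ^W`. -/
theorem map_mu (hW : IsNetwork W) :
    (mu W).map (fun x => (betaV W (pin x.1), thetaV W (pin x.1) (pin x.2))) = nu W := by
  refine Measure.ext_of_lintegral _ fun f hf => ?_
  have hS : MeasurableSet {x : (ι → ℝ) × (ι → ℝ) | (matH W x.1).PosDef} :=
    measurable_fst (measurableSet_posDef_matH hW)
  have hν := (measurable_nuDensity W).ennreal_ofReal
  have hL : Measurable fun x => ENNReal.ofReal (nuDensity W x) * f x := hν.mul hf
  have hΦ := measurable_beta_theta W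
  have hm := (measurable_rho_mul W).ennreal_ofReal
  rw [lintegral_map hf hΦ, mu, ← Function.comp_def f,
    lintegral_withDensity_eq_lintegral_mul _ hm (hf.comp hΦ), nu,
    lintegral_withDensity_eq_lintegral_mul _ (hν.indicator hS) hf]
  have hR : ∫⁻ x, ({x : (ι → ℝ) × (ι → ℝ) | (matH W x.1).PosDef}.indicator
      (fun x => ENNReal.ofReal (nuDensity W x)) * f) x =
      ∫⁻ β in {β : ι → ℝ | (matH W β).PosDef},
        ∫⁻ θ, ENNReal.ofReal (nuDensity W (β, θ)) * f (β, θ) := by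
    rw [Measure.volume_eq_prod, lintegral_prod _ ((hν.indicator hS).mul hf).aemeasurable,
      ← lintegral_indicator (measurableSet_posDef_matH hW)]
    refine lintegral_congr fun β => ?_
    by_cases h : (matH W β).PosDef
    · simp [Set.indicator, h]
    · simp [Set.indicator, h]
  rw [hR, ← range_betaV hW, ← Set.image_univ,
    lintegral_image_eq_lintegral_abs_det_fderiv_mul volume MeasurableSet.univ
      (fun u _ => (hasFDerivAt_betaV hW.diag u).hasFDerivWithinAt)
      (injective_betaV hW).injOn, setLIntegral_univ, Measure.volume_eq_prod,
    lintegral_prod _ (hm.mul (hf.comp hΦ)).aemeasurable]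
  refine lintegral_congr fun u => ?_
  have hdetB : (matB W u).det ≠ 0 := by
    rw [det_matB]
    exact (mul_pos (Finset.prod_pos fun i _ => Real.exp_pos _)
      (posDef_matAV hW (pin u)).det_pos).ne'
  have hJ : (LinearMap.toContinuousLinearMap (Matrix.toLin' (jacBeta W u))).det =
      (jacBeta W u).det := by
    rw [ContinuousLinearMap.det, LinearMap.coe_toContinuousLinearMap, LinearMap.det_toLin']
  have hLu : Measurable fun θ => ENNReal.ofReal (nuDensity W (betaV W (pin u), θ)) *
      f (betaV W (pin u), θ) := hL.comp measurable_prodMk_left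
  have hcongr : ∀ s, ((fun x : (ι → ℝ) × (ι → ℝ) => ENNReal.ofReal (rho W (pin x.1) (pin x.2) *
      ∏ i, (1 / (2 * Real.pi) * Real.exp (-x.1 i)))) *
      (f ∘ fun x : (ι → ℝ) × (ι → ℝ) =>
        (betaV W (pin x.1), thetaV W (pin x.1) (pin x.2)))) (u, s) =
      ENNReal.ofReal (|(jacBeta W u).det| * |(matB W u).det|) *
        (ENNReal.ofReal (nuDensity W (betaV W (pin u), (matB W u).mulVec s)) *
          f (betaV W (pin u), (matB W u).mulVec s)) := by
    intro s
    simp only [Pi.mul_apply, Function.comp_apply, thetaV_eq]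
    rw [rho_eq hW, ENNReal.ofReal_mul (by positivity), mul_assoc]
  rw [lintegral_congr hcongr, lintegral_const_mul' _ _ ENNReal.ofReal_ne_top,
    lintegral_comp_mulVec hdetB hLu,
    ← mul_assoc, ← ENNReal.ofReal_mul (by positivity), hJ]
  congr 2
  rw [mul_assoc, abs_inv, mul_inv_cancel₀ (abs_ne_zero.2 hdetB), mul_one]

end ChangeOfVariables

/-! ### Integrability of monomials in the complex field -/

section Integrability
theorem abs_pin_le {ι : Type*} [Fintype ι] (u : ι → ℝ) (j : Option ι) : |pin u j| ≤ ∑ i, |u i| := by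
  cases j with
  | none => simpa [pin] using Finset.sum_nonneg fun i _ => abs_nonneg (u i)
  | some i =>
    exact Finset.single_le_sum (f := fun i => |u i|) (fun i _ => abs_nonneg _) (Finset.mem_univ i)

variable {ι : Type*} [Fintype ι] [DecidableEq ι] {W : Option ι → Option ι → ℝ}

/-- The complex field `e^{u_j} (1 + i s_j) = (H_β⁻¹ (η + i θ))_j` as a function of `(β, θ)`; it is
`1` at the pinned vertex. -/
def field (W : Option ι → Option ι → ℝ) (x : (ι → ℝ) × (ι → ℝ)) : Option ι → ℂ
  | none => 1
  | some i => (((matH W x.1)⁻¹.mulVec (etaV W) i : ℝ) : ℂ) +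
      Complex.I * (((matH W x.1)⁻¹.mulVec x.2 i : ℝ) : ℂ)

theorem measurable_field (W : Option ι → Option ι → ℝ) (j : Option ι) :
    Measurable fun x => field W x j := by
  cases j with
  | none => exact measurable_const
  | some i =>
    have h1 := measurable_inv_matH_mulVec W i
    have h2 := measurable_inv_matH_mulVec_const W (etaV W) i
    simp only [field]
    fun_prop

/-- On the domain of positive definiteness the field is `e^{u_j} (1 + i s_j)` with `u = f(β)` and
`s = g(β, θ)`. -/
theorem field_eq (hW : IsNetwork W) {β : ι → ℝ} (hβ : (matH W β).PosDef) (θ : ι → ℝ)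
    (j : Option ι) :
    field W (β, θ) j = (Real.exp (uOfBeta W β j) : ℂ) *
      (1 + Complex.I * (sOfBetaTheta W β θ j : ℂ)) := by
  cases j with
  | none => simp [field, uOfBeta, sOfBetaTheta, pin]
  | some i =>
    simp only [field]
    rw [← exp_uOfBeta hW hβ, ← exp_mul_sOfBetaTheta hW hβ θ]
    push_cast
    ring

theorem field_beta_theta (hW : IsNetwork W) (u s : ι → ℝ) (j : Option ι) :
    field W (betaV W (pin u), thetaV W (pin u) (pin s)) j =
      (Real.exp (pin u j) : ℂ) * (1 + Complex.I * (pin s j : ℂ)) := by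
  have hH := posDef_matH_betaV hW u
  have h1 := inv_mulVec_eq_of_mulVec_eq hH (matH_betaV_mulVec_exp u)
  have h2 : (matH W (betaV W (pin u))).mulVec (fun i => Real.exp (u i) * s i) =
      (matB W u).mulVec s := by
    rw [matH_betaV hW.diag, matB, ← Matrix.mulVec_mulVec]
    congr 1
    funext i
    rw [Matrix.mulVec_diagonal, ← mul_assoc, ← Real.exp_add, neg_add_cancel, Real.exp_zero, one_mul]
  cases j with
  | none => simp [field, pin]
  | some i =>
    simp only [field, thetaV_eq, h1, inv_mulVec_eq_of_mulVec_eq hH h2, pin]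
    push_cast
    ring

theorem one_add_sq_div_two_le_cosh (x : ℝ) : 1 + x ^ 2 / 2 ≤ Real.cosh x := by
  have h : (x / 2) ^ 2 ≤ Real.sinh (x / 2) ^ 2 := by
    rcases le_total 0 (x / 2) with h | h
    · exact pow_le_pow_left₀ h (Real.self_le_sinh_iff.2 h) 2
    · exact sq_le_sq.2 (by
        have := Real.sinh_le_self_iff.2 h
        rw [abs_of_nonpos h, abs_of_nonpos (this.trans h)]
        linarith)
  have h1 := Real.cosh_two_mul (x / 2)
  rw [Real.cosh_sq, mul_div_cancel₀ x two_ne_zero] at h1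
  linarith

theorem one_add_sq_pow_mul_exp_le (m : ℕ) {ε : ℝ} (hε : 0 < ε) (t : ℝ) :
    (1 + t ^ 2) ^ m * Real.exp (-(ε * t ^ 2)) ≤ m.factorial * Real.exp ε / ε ^ m := by
  have h := Real.pow_div_factorial_le_exp (ε * (1 + t ^ 2)) (by positivity) m
  rw [mul_pow, mul_add, Real.exp_add, mul_one, div_le_iff₀ (by positivity)] at h
  rw [Real.exp_neg, ← div_eq_mul_inv, div_le_div_iff₀ (Real.exp_pos _) (by positivity)]
  linarith

theorem det_matAV_le (hW : IsNetwork W) (u : ι → ℝ) :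
    (matAV W (pin u)).det ≤ (Fintype.card ι).factorial * (∑ i, ∑ j, W i j) ^ Fintype.card ι *
      Real.exp (2 * Fintype.card ι * ∑ i, |u i|) := by
  set N := ∑ i, |u i| with hN
  have he : ∀ i j, Real.exp (pin u i + pin u j) ≤ Real.exp (2 * N) := by
    intro i j
    refine Real.exp_le_exp.2 ?_
    linarith [le_abs_self (pin u i), le_abs_self (pin u j), abs_pin_le u i, abs_pin_le u j]
  have hrow : ∀ i, ∑ j, W i j ≤ ∑ i, ∑ j, W i j := fun i =>
    Finset.single_le_sum (f := fun i => ∑ j, W i j)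
      (fun i _ => Finset.sum_nonneg fun j _ => hW.nonneg i j) (Finset.mem_univ i)
  have hent : ∀ i j, W i j ≤ ∑ i, ∑ j, W i j := fun i j =>
    (Finset.single_le_sum (f := fun j => W i j) (fun j _ => hW.nonneg i j)
      (Finset.mem_univ j)).trans (hrow i)
  have hb : ∀ i j, |matAV W (pin u) i j| ≤ (∑ i, ∑ j, W i j) * Real.exp (2 * N) := by
    intro i j
    simp only [matAV, matA, Matrix.submatrix_apply, Matrix.of_apply]
    split_ifs
    · rw [abs_of_nonneg (Finset.sum_nonneg fun k _ =>
        mul_nonneg (hW.nonneg _ _) (Real.exp_pos _).le)]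
      calc ∑ k, W (some i) k * Real.exp (pin u (some i) + pin u k)
          ≤ ∑ k, W (some i) k * Real.exp (2 * N) :=
            Finset.sum_le_sum fun k _ => mul_le_mul_of_nonneg_left (he _ _) (hW.nonneg _ _)
        _ = (∑ k, W (some i) k) * Real.exp (2 * N) := by rw [Finset.sum_mul]
        _ ≤ _ := mul_le_mul_of_nonneg_right (hrow _) (Real.exp_pos _).le
    · rw [abs_neg, abs_of_nonneg (mul_nonneg (hW.nonneg _ _) (Real.exp_pos _).le)]
      exact mul_le_mul (hent _ _) (he _ _) (Real.exp_pos _).le ((hW.nonneg (some i) (some j)).trans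
        (hent _ _))
  have h := Matrix.det_le (abv := AbsoluteValue.abs) hb
  refine (le_abs_self _).trans (h.trans (le_of_eq ?_))
  rw [nsmul_eq_mul, mul_pow, ← Real.exp_nat_mul, mul_assoc]
  congr 3
  ring

/-- Gaussian domination of the density of `μ^W` times a monomial in the fields. -/
theorem exists_bound_rho (hW : IsNetwork W) (k : ℕ) (j : Fin k → Option ι) :
    ∃ C c : ℝ, 0 < c ∧ ∀ u s : ι → ℝ,
      (rho W (pin u) (pin s) * ∏ i, (1 / (2 * Real.pi) * Real.exp (-u i))) *
        ‖∏ l, (Real.exp (pin u (j l)) : ℂ) * (1 + Complex.I * (pin s (j l) : ℂ))‖ ≤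
      C * ((∏ i, Real.exp (-c * u i ^ 2)) * ∏ i, (1 + s i ^ 2)⁻¹) := by
  obtain ⟨c, hc, hcv⟩ := exists_mul_sum_sq_le hW
  set n := Fintype.card ι with hn
  set w := ∑ i, ∑ j, W i j with hw
  have hw0 : 0 ≤ w := Finset.sum_nonneg fun i _ => Finset.sum_nonneg fun j _ => hW.nonneg i j
  set K : ℝ := 2 * n + 1 + k + 2 * ((k + 1 : ℕ) * n) with hK
  have hK0 : 0 ≤ K := by positivity
  set C₁ : ℝ := (n.factorial * w ^ n) *
    ((k + 1).factorial * Real.exp (c / 2) / (c / 2) ^ (k + 1)) ^ n with hC₁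
  have hC₁0 : 0 ≤ C₁ := by positivity
  refine ⟨C₁ * Real.exp (K ^ 2 / c) ^ n, c / 4, by positivity, fun u s => ?_⟩
  set N := ∑ i, |u i| with hN
  have hN0 : 0 ≤ N := Finset.sum_nonneg fun i _ => abs_nonneg _
  set P := ∏ i, (1 + s i ^ 2) with hP
  have hP1 : ∀ i, 1 ≤ 1 + s i ^ 2 := fun i => by nlinarith [sq_nonneg (s i)]
  have hP0 : 0 < P := Finset.prod_pos fun i _ => one_pos.trans_le (hP1 i)
  -- the monomial
  have hF : ‖∏ l, (Real.exp (pin u (j l)) : ℂ) * (1 + Complex.I * (pin s (j l) : ℂ))‖ ≤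
      Real.exp (k * N) * P ^ k := by
    rw [norm_prod, Real.exp_nat_mul, ← mul_pow]
    refine (Finset.prod_le_prod (fun l _ => norm_nonneg _) (g := fun _ => Real.exp N * P)
      fun l _ => ?_).trans (by simp)
    rw [norm_mul, Complex.norm_real, Real.norm_eq_abs, Real.abs_exp]
    refine mul_le_mul (Real.exp_le_exp.2 ((le_abs_self _).trans (abs_pin_le u _))) ?_
      (norm_nonneg _) (Real.exp_pos _).le
    have hs : 1 + (pin s (j l)) ^ 2 ≤ P := by
      cases j l with
      | none => simpa [pin] using Finset.one_le_prod (s := Finset.univ) fun i _ => hP1 i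
      | some i =>
        have := Finset.prod_le_prod_of_subset_of_one_le (f := fun i => 1 + s i ^ 2)
          (Finset.subset_univ {i}) (fun i _ => zero_le_one.trans (hP1 i)) (fun i _ _ => hP1 i)
        rwa [Finset.prod_singleton] at this
    refine le_trans ?_ hs
    have h1 : ‖(1 : ℂ) + Complex.I * (pin s (j l) : ℂ)‖ = Real.sqrt (1 + pin s (j l) ^ 2) := by
      have := Complex.norm_add_mul_I 1 (pin s (j l))
      rw [mul_comm]
      simpa using this
    rw [h1]
    refine Real.sqrt_le_iff.2 ⟨by positivity, ?_⟩
    nlinarith [sq_nonneg (pin s (j l))]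
  -- the energy of `u`
  have hE : Real.exp (-(1 / 2) * ∑ i, ∑ j, W i j * (Real.cosh (pin u i - pin u j) - 1)) ≤
      Real.exp (-(c / 2) * ∑ i, u i ^ 2) := by
    refine Real.exp_le_exp.2 ?_
    have h1 := hcv u
    have h2 : ∑ i, ∑ j, W i j * (pin u i - pin u j) ^ 2 ≤
        2 * ∑ i, ∑ j, W i j * (Real.cosh (pin u i - pin u j) - 1) := by
      simp only [Finset.mul_sum]
      refine Finset.sum_le_sum fun i _ => Finset.sum_le_sum fun j _ => ?_
      have h3 := one_add_sq_div_two_le_cosh (pin u i - pin u j)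
      nlinarith [hW.nonneg i j]
    linarith
  -- the energy of `s`
  set ε := c / 2 * Real.exp (-(2 * N)) with hε
  have hε0 : 0 < ε := by positivity
  have hεc : ε ≤ c / 2 := by
    rw [hε]
    exact mul_le_of_le_one_right (by positivity) (Real.exp_le_one_iff.2 (by linarith))
  have hQ : Real.exp (-(1 / 2) * (pin s ⬝ᵥ (matA W (pin u)).mulVec (pin s))) ≤
      ∏ i, Real.exp (-(ε * s i ^ 2)) := by
    rw [← Real.exp_sum, Finset.sum_neg_distrib, ← Finset.mul_sum]
    refine Real.exp_le_exp.2 ?_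
    rw [pin_dotProduct_matA_mulVec, dotProduct_matAV_mulVec hW.symm hW.diag]
    have h1 := hcv s
    have h2 : Real.exp (-(2 * N)) * ∑ i, ∑ j, W i j * (pin s i - pin s j) ^ 2 ≤
        ∑ i, ∑ j, W i j * Real.exp (pin u i + pin u j) * (pin s i - pin s j) ^ 2 := by
      simp only [Finset.mul_sum]
      refine Finset.sum_le_sum fun i _ => Finset.sum_le_sum fun j _ => ?_
      have h3 : Real.exp (-(2 * N)) ≤ Real.exp (pin u i + pin u j) := by
        refine Real.exp_le_exp.2 ?_
        linarith [neg_abs_le (pin u i), neg_abs_le (pin u j), abs_pin_le u i, abs_pin_le u j]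
      have h4 : 0 ≤ W i j * (pin s i - pin s j) ^ 2 := mul_nonneg (hW.nonneg i j) (sq_nonneg _)
      nlinarith
    have h5 := mul_le_mul_of_nonneg_left h1 (Real.exp_pos (-(2 * N))).le
    rw [hε]
    nlinarith
  have hPQ : P ^ (k + 1) * ∏ i, Real.exp (-(ε * s i ^ 2)) ≤
      ((k + 1).factorial * Real.exp (c / 2) / (c / 2) ^ (k + 1)) ^ n *
        Real.exp (2 * ((k + 1 : ℕ) * n) * N) := by
    rw [hP, ← Finset.prod_pow, ← Finset.prod_mul_distrib]
    refine (Finset.prod_le_prod (fun i _ => by positivity) (g := fun _ =>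
      (k + 1).factorial * Real.exp (c / 2) / (c / 2) ^ (k + 1) *
        Real.exp (2 * (k + 1 : ℕ) * N)) fun i _ => ?_).trans (le_of_eq ?_)
    · refine (one_add_sq_pow_mul_exp_le (k + 1) hε0 (s i)).trans ?_
      have h6 : ε ^ (k + 1) = (c / 2) ^ (k + 1) / Real.exp (2 * (k + 1 : ℕ) * N) := by
        rw [hε, mul_pow, ← Real.exp_nat_mul, div_eq_mul_inv _ (Real.exp _), ← Real.exp_neg]
        congr 2
        push_cast
        ring
      rw [h6, div_div_eq_mul_div, mul_div_right_comm]
      gcongr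
    · rw [Finset.prod_const, Finset.card_univ, mul_pow, ← Real.exp_nat_mul]
      congr 2
      ring
  -- the remaining factors
  have hD := det_matAV_le hW u
  have hM : ∏ i, (1 / (2 * Real.pi) * Real.exp (-u i)) ≤ Real.exp N := by
    rw [hN, Real.exp_sum]
    refine Finset.prod_le_prod (fun i _ => by positivity) fun i _ => ?_
    have h7 : 1 / (2 * Real.pi) ≤ 1 := by
      rw [div_le_one (by positivity)]
      linarith [Real.pi_gt_three]
    calc 1 / (2 * Real.pi) * Real.exp (-u i) ≤ 1 * Real.exp (-u i) := by gcongr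
      _ ≤ Real.exp |u i| := by
        rw [one_mul]
        exact Real.exp_le_exp.2 (neg_le_abs _)
  have hG : Real.exp (K * N) * Real.exp (-(c / 2) * ∑ i, u i ^ 2) ≤
      Real.exp (K ^ 2 / c) ^ n * ∏ i, Real.exp (-(c / 4) * u i ^ 2) := by
    rw [← Real.exp_add, hN, Finset.mul_sum, Finset.mul_sum, ← Finset.sum_add_distrib, Real.exp_sum,
      hn, ← Finset.card_univ, ← Finset.prod_const, ← Finset.prod_mul_distrib]
    refine Finset.prod_le_prod (fun i _ => (Real.exp_pos _).le) fun i _ => ?_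
    rw [← Real.exp_add]
    refine Real.exp_le_exp.2 ?_
    -- complete the square to absorb the linear exponent `K |u_i|` into the Gaussian
    have h8 : 0 ≤ (K - c / 2 * |u i|) ^ 2 / c := by positivity
    have h9 : (K - c / 2 * |u i|) ^ 2 / c = K ^ 2 / c - K * |u i| + c / 4 * u i ^ 2 := by
      rw [← sq_abs (u i)]
      field_simp
      ring
    linarith
  have hA0 : 0 ≤ (matAV W (pin u)).det := (posDef_matAV hW _).det_pos.le
  calc (rho W (pin u) (pin s) * ∏ i, (1 / (2 * Real.pi) * Real.exp (-u i))) *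
        ‖∏ l, (Real.exp (pin u (j l)) : ℂ) * (1 + Complex.I * (pin s (j l) : ℂ))‖
      ≤ (((∏ i, Real.exp (-(ε * s i ^ 2))) * (n.factorial * w ^ n * Real.exp (2 * n * N)) *
          Real.exp (-(c / 2) * ∑ i, u i ^ 2)) * Real.exp N) * (Real.exp (k * N) * P ^ k) := by
        unfold rho
        gcongr
    _ = (P ^ (k + 1) * ∏ i, Real.exp (-(ε * s i ^ 2))) * (n.factorial * w ^ n) *
          (Real.exp (2 * n * N) * Real.exp N * Real.exp (k * N)) *
          Real.exp (-(c / 2) * ∑ i, u i ^ 2) * P⁻¹ := by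
        rw [pow_succ]
        field_simp
    _ ≤ (((k + 1).factorial * Real.exp (c / 2) / (c / 2) ^ (k + 1)) ^ n *
        Real.exp (2 * ((k + 1 : ℕ) * n) * N)) * (n.factorial * w ^ n) *
          (Real.exp (2 * n * N) * Real.exp N * Real.exp (k * N)) *
          Real.exp (-(c / 2) * ∑ i, u i ^ 2) * P⁻¹ := by gcongr
    _ = C₁ * (Real.exp (K * N) * Real.exp (-(c / 2) * ∑ i, u i ^ 2)) * P⁻¹ := by
        have : Real.exp (K * N) = Real.exp (2 * ((k + 1 : ℕ) * n) * N) *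
            (Real.exp (2 * n * N) * Real.exp N * Real.exp (k * N)) := by
          simp only [← Real.exp_add]
          congr 1
          rw [hK]
          ring
        rw [this, hC₁]
        ring
    _ ≤ C₁ * (Real.exp (K ^ 2 / c) ^ n * ∏ i, Real.exp (-(c / 4) * u i ^ 2)) * P⁻¹ := by gcongr
    _ = _ := by
        rw [hP, Finset.prod_inv_distrib]
        ring

theorem integrable_prod_field (hW : IsNetwork W) (k : ℕ) (j : Fin k → Option ι) :
    Integrable (fun x => ∏ l, field W x (j l)) (nu W) := by
  have hm : Measurable fun x => ∏ l, field W x (j l) :=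
    Finset.measurable_prod _ fun l _ => measurable_field W (j l)
  have hd := measurable_rho_mul W
  rw [← map_mu hW, integrable_map_measure hm.aestronglyMeasurable
    (measurable_beta_theta W).aemeasurable, mu, integrable_withDensity_iff_integrable_smul'
    hd.ennreal_ofReal (Filter.Eventually.of_forall fun x => ENNReal.ofReal_lt_top)]
  obtain ⟨C, c, hc, hb⟩ := exists_bound_rho hW k j
  have hint : Integrable (fun x : (ι → ℝ) × (ι → ℝ) =>
      C * ((∏ i, Real.exp (-c * x.1 i ^ 2)) * ∏ i, (1 + x.2 i ^ 2)⁻¹)) := by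
    refine Integrable.const_mul ?_ C
    refine Integrable.mul_prod (f := fun u : ι → ℝ => ∏ i, Real.exp (-c * u i ^ 2))
      (g := fun s : ι → ℝ => ∏ i, (1 + s i ^ 2)⁻¹) ?_ ?_
    · exact Integrable.fintype_prod fun i => integrable_exp_neg_mul_sq hc
    · exact Integrable.fintype_prod fun i => integrable_inv_one_add_sq
  refine hint.mono' ?_ (Filter.Eventually.of_forall fun x => ?_)
  · exact (hd.ennreal_ofReal.ennreal_toReal.smul
      (hm.comp (measurable_beta_theta W))).aestronglyMeasurable
  · have h0 : 0 ≤ rho W (pin x.1) (pin x.2) * ∏ i, (1 / (2 * Real.pi) * Real.exp (-x.1 i)) := by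
      have := (posDef_matAV hW (pin x.1)).det_pos
      unfold rho
      positivity
    rw [norm_smul, ENNReal.toReal_ofReal h0, Real.norm_eq_abs, abs_of_nonneg h0]
    simp only [Function.comp_apply, field_beta_theta hW]
    exact hb x.1 x.2

end Integrability

/-! ### Elimination of a vertex: Schur complements -/

/-- The vector on `ι ≃ κ ⊕ Unit` with the entries of `v` on `κ` and the entry `y` at the additional
vertex. -/
def extend {ι κ : Type*} (e : κ ⊕ Unit ≃ ι) (v : κ → ℝ) (y : ℝ) : ι → ℝ :=
  fun i => Sum.elim v (fun _ => y) (e.symm i)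

section Extend
variable {ι κ : Type*} {e : κ ⊕ Unit ≃ ι}

@[simp] theorem extend_inl (v : κ → ℝ) (y : ℝ) (i : κ) : extend e v y (e (Sum.inl i)) = v i := by
  simp [extend]

@[simp] theorem extend_inr (v : κ → ℝ) (y : ℝ) : extend e v y (e (Sum.inr ())) = y := by
  simp [extend]

theorem forall_equiv_sum_unit {p : ι → Prop} :
    (∀ i, p i) ↔ (∀ i, p (e (Sum.inl i))) ∧ p (e (Sum.inr ())) := by
  rw [← e.forall_congr_right, Sum.forall]
  exact and_congr Iff.rfl ⟨fun h => h (), fun h _ => h⟩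

theorem extend_surjective (w : ι → ℝ) :
    w = extend e (fun i => w (e (Sum.inl i))) (w (e (Sum.inr ()))) := by
  funext i
  exact (forall_equiv_sum_unit (e := e)
    (p := fun i => w i = extend e (fun i => w (e (Sum.inl i))) (w (e (Sum.inr ()))) i)).2
    ⟨fun i => by simp, by simp⟩ i

variable [Fintype ι] [Fintype κ]

theorem sum_equiv_sum_unit {M : Type*} [AddCommMonoid M] (f : ι → M) :
    ∑ i, f i = ∑ i, f (e (Sum.inl i)) + f (e (Sum.inr ())) := by
  rw [← e.sum_comp, Fintype.sum_sum_type]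
  simp

theorem extend_dotProduct_extend (v w : κ → ℝ) (y z : ℝ) :
    extend e v y ⬝ᵥ extend e w z = v ⬝ᵥ w + y * z := by
  rw [dotProduct, sum_equiv_sum_unit (e := e)]
  simp [dotProduct]

theorem dotProduct_mulVec_comm {H : Matrix κ κ ℝ} (hH : H.PosDef) (v w : κ → ℝ) :
    v ⬝ᵥ H.mulVec w = w ⬝ᵥ H.mulVec v := by
  have h : H.transpose = H := by
    have := hH.isHermitian
    rwa [Matrix.IsHermitian, Matrix.conjTranspose_eq_transpose_of_trivial] at this
  rw [Matrix.dotProduct_mulVec, ← Matrix.mulVec_transpose, h, dotProduct_comm]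

end Extend

section Contraction
variable {ι κ : Type*}

/-- `W` is the network obtained from `W'` by merging the vertex `e (inr ())` with the pinned
vertex. -/
structure IsContraction (e : κ ⊕ Unit ≃ ι) (W : Option κ → Option κ → ℝ)
    (W' : Option ι → Option ι → ℝ) : Prop where
  net : IsNetwork W
  net' : IsNetwork W'
  inner : ∀ i j, W (some i) (some j) = W' (some (e (Sum.inl i))) (some (e (Sum.inl j)))
  boundary : ∀ i, W (some i) none =
    W' (some (e (Sum.inl i))) none + W' (some (e (Sum.inl i))) (some (e (Sum.inr ())))

/-- The weights between the old vertices and the additional vertex. -/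
def newWeight (e : κ ⊕ Unit ≃ ι) (W' : Option ι → Option ι → ℝ) : κ → ℝ :=
  fun i => W' (some (e (Sum.inl i))) (some (e (Sum.inr ())))

/-- The weights between the old vertices and the pinned vertex of the larger network. -/
def oldEta (e : κ ⊕ Unit ≃ ι) (W' : Option ι → Option ι → ℝ) : κ → ℝ :=
  fun i => etaV W' (e (Sum.inl i))

theorem IsContraction.etaV_eq {e : κ ⊕ Unit ≃ ι} {W : Option κ → Option κ → ℝ}
    {W' : Option ι → Option ι → ℝ} (h : IsContraction e W W') :
    etaV W = oldEta e W' + newWeight e W' := by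
  funext i
  exact h.boundary i

theorem etaV_eq_extend {e : κ ⊕ Unit ≃ ι} {W' : Option ι → Option ι → ℝ} :
    etaV W' = extend e (oldEta e W') (etaV W' (e (Sum.inr ()))) :=
  extend_surjective _

end Contraction

section Schur
variable {ι κ : Type*} [Fintype ι] [DecidableEq ι] [Fintype κ] [DecidableEq κ]
variable {e : κ ⊕ Unit ≃ ι} {W : Option κ → Option κ → ℝ} {W' : Option ι → Option ι → ℝ}

theorem IsContraction.matH_mulVec_extend (h : IsContraction e W W') (β v : κ → ℝ) (b y : ℝ) :
    (matH W' (extend e β b)).mulVec (extend e v y) =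
      extend e ((matH W β).mulVec v - y • newWeight e W')
        (2 * b * y - newWeight e W' ⬝ᵥ v) := by
  funext i
  refine (forall_equiv_sum_unit (e := e) (p := fun i => (matH W' (extend e β b)).mulVec
    (extend e v y) i = extend e ((matH W β).mulVec v - y • newWeight e W')
        (2 * b * y - newWeight e W' ⬝ᵥ v) i)).2 ⟨fun i => ?_, ?_⟩ i
  · rw [matH_mulVec, sum_equiv_sum_unit (e := e)]
    simp only [extend_inl, extend_inr, Pi.sub_apply, Pi.smul_apply, matH_mulVec, h.inner,
      newWeight, smul_eq_mul]
    ring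
  · rw [matH_mulVec, sum_equiv_sum_unit (e := e)]
    simp only [extend_inl, extend_inr, newWeight, dotProduct, h.net'.diag, zero_mul, add_zero]
    simp only [h.net'.symm (some (e (Sum.inr ())))]

/-- The Schur complement of `H_β` at the additional vertex is `2 b - schurShift`. -/
def schurShift (e : κ ⊕ Unit ≃ ι) (W : Option κ → Option κ → ℝ) (W' : Option ι → Option ι → ℝ)
    (β : κ → ℝ) : ℝ :=
  newWeight e W' ⬝ᵥ (matH W β)⁻¹.mulVec (newWeight e W')

theorem dotProduct_inv_mulVec_comm {H : Matrix κ κ ℝ} (hH : H.PosDef) (v w : κ → ℝ) :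
    v ⬝ᵥ H⁻¹.mulVec w = w ⬝ᵥ H⁻¹.mulVec v := by
  have h : (H⁻¹).transpose = H⁻¹ := by
    have := hH.inv.isHermitian
    rwa [Matrix.IsHermitian, Matrix.conjTranspose_eq_transpose_of_trivial] at this
  rw [Matrix.dotProduct_mulVec, ← Matrix.mulVec_transpose, h, dotProduct_comm]

/-- Positive definiteness by completing the square in the old variables. -/
theorem IsContraction.posDef_iff (h : IsContraction e W W') (β : κ → ℝ) (b : ℝ) :
    (matH W' (extend e β b)).PosDef ↔
      (matH W β).PosDef ∧ 0 < 2 * b - schurShift e W W' β := by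
  have hq : ∀ (v : κ → ℝ) (y : ℝ), extend e v y ⬝ᵥ (matH W' (extend e β b)).mulVec (extend e v y) =
      v ⬝ᵥ (matH W β).mulVec v - 2 * y * (newWeight e W' ⬝ᵥ v) + 2 * b * y ^ 2 := by
    intro v y
    rw [h.matH_mulVec_extend, extend_dotProduct_extend, dotProduct_sub, dotProduct_smul,
      dotProduct_comm v (newWeight e W'), smul_eq_mul]
    ring
  constructor
  · intro hH'
    have hH : (matH W β).PosDef := by
      refine Matrix.PosDef.of_dotProduct_mulVec_pos (isHermitian_matH h.net.symm β) fun v hv => ?_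
      have h0 : extend e v 0 ≠ 0 := by
        intro h0
        exact hv (funext fun i => by simpa using congrFun h0 (e (Sum.inl i)))
      have := hH'.dotProduct_mulVec_pos h0
      rw [star_trivial, hq] at this
      simpa using this
    refine ⟨hH, ?_⟩
    have h0 : extend e ((matH W β)⁻¹.mulVec (newWeight e W')) 1 ≠ 0 := by
      intro h0
      simpa using congrFun h0 (e (Sum.inr ()))
    have := hH'.dotProduct_mulVec_pos h0
    rw [star_trivial, hq, mulVec_inv_mulVec hH, dotProduct_comm _ (newWeight e W')] at this
    unfold schurShift
    linarith
  · rintro ⟨hH, hg⟩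
    refine Matrix.PosDef.of_dotProduct_mulVec_pos (isHermitian_matH h.net'.symm _) fun w hw => ?_
    obtain ⟨v, y, rfl⟩ : ∃ v y, w = extend e v y := ⟨_, _, extend_surjective w⟩
    set p := (matH W β)⁻¹.mulVec (newWeight e W') with hp
    have hsq : v ⬝ᵥ (matH W β).mulVec v - 2 * y * (newWeight e W' ⬝ᵥ v) + 2 * b * y ^ 2 =
        (v - y • p) ⬝ᵥ (matH W β).mulVec (v - y • p) + (2 * b - schurShift e W W' β) * y ^ 2 := by
      have h1 : (matH W β).mulVec p = newWeight e W' := mulVec_inv_mulVec hH _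
      rw [Matrix.mulVec_sub, Matrix.mulVec_smul, h1, sub_dotProduct, dotProduct_sub, dotProduct_sub,
        smul_dotProduct, smul_dotProduct, dotProduct_smul, dotProduct_smul,
        dotProduct_mulVec_comm hH p v, h1, dotProduct_comm v (newWeight e W'),
        dotProduct_comm p (newWeight e W')]
      simp only [schurShift, smul_eq_mul, ← hp]
      ring
    rw [star_trivial, hq, hsq]
    by_cases hy : y = 0
    · subst hy
      have hv : v ≠ 0 := by
        rintro rfl
        refine hw (funext fun i => ?_)
        exact (forall_equiv_sum_unit (e := e) (p := fun i => extend e (0 : κ → ℝ) 0 i = 0)).2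
          ⟨fun i => by simp, by simp⟩ i
      have := hH.dotProduct_mulVec_pos hv
      rw [star_trivial] at this
      simpa using this
    · have h1 := hH.posSemidef.dotProduct_mulVec_nonneg (v - y • p)
      rw [star_trivial] at h1
      have h2 : 0 < y ^ 2 := by positivity
      have := mul_pos hg h2
      linarith

theorem IsContraction.det_matH (h : IsContraction e W W') {β : κ → ℝ} (hH : (matH W β).PosDef)
    (b : ℝ) :
    (matH W' (extend e β b)).det = (matH W β).det * (2 * b - schurShift e W W' β) := by
  have hblock : (matH W' (extend e β b)).submatrix e e =
      Matrix.fromBlocks (matH W β) (Matrix.of fun i _ => -newWeight e W' i)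
        (Matrix.of fun _ i => -newWeight e W' i) (Matrix.of fun _ _ : Unit => 2 * b) := by
    ext i j
    rcases i with i | i <;> rcases j with j | j
    · simp only [Matrix.submatrix_apply, Matrix.fromBlocks_apply₁₁, matH, Matrix.sub_apply,
        Matrix.of_apply, h.inner, Matrix.diagonal_apply, EmbeddingLike.apply_eq_iff_eq,
        Sum.inl.injEq, extend_inl]
    · simp [matH, newWeight]
    · simp [matH, newWeight, h.net'.symm (some (e (Sum.inr ())))]
    · simp only [Matrix.submatrix_apply, Matrix.fromBlocks_apply₂₂, matH, Matrix.sub_apply,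
        Matrix.of_apply, h.net'.diag, Matrix.diagonal_apply_eq, sub_zero, Subsingleton.elim i (),
        Subsingleton.elim j (), extend_inr]
  have := (isUnit_det_of_posDef hH).invertible
  have := (matH W β).invertibleOfDetInvertible
  rw [← Matrix.det_submatrix_equiv_self e, hblock, Matrix.det_fromBlocks₁₁, Matrix.invOf_eq_nonsing_inv]
  congr 1
  rw [Matrix.det_unique, Matrix.sub_apply, Matrix.mul_assoc, Matrix.mul_apply]
  simp only [schurShift, dotProduct, Matrix.mulVec, Matrix.of_apply, Matrix.mul_apply, mul_neg,
    Finset.sum_neg_distrib, neg_mul, neg_neg]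

/-- Block elimination: solve the last equation for the additional coordinate and substitute. -/
theorem IsContraction.inv_mulVec_extend (h : IsContraction e W W') {β : κ → ℝ}
    (hH : (matH W β).PosDef) {b : ℝ} (hg : 0 < 2 * b - schurShift e W W' β) (v : κ → ℝ) (r : ℝ) :
    (matH W' (extend e β b))⁻¹.mulVec (extend e v r) =
      extend e ((matH W β)⁻¹.mulVec v +
        ((r + newWeight e W' ⬝ᵥ (matH W β)⁻¹.mulVec v) / (2 * b - schurShift e W W' β)) •
          (matH W β)⁻¹.mulVec (newWeight e W'))
        ((r + newWeight e W' ⬝ᵥ (matH W β)⁻¹.mulVec v) / (2 * b - schurShift e W W' β)) := by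
  set g := 2 * b - schurShift e W W' β with hgdef
  set y := (r + newWeight e W' ⬝ᵥ (matH W β)⁻¹.mulVec v) / g with hy
  refine inv_mulVec_eq_of_mulVec_eq ((h.posDef_iff β b).2 ⟨hH, hg⟩) ?_
  rw [h.matH_mulVec_extend, Matrix.mulVec_add, Matrix.mulVec_smul, mulVec_inv_mulVec hH,
    mulVec_inv_mulVec hH, add_sub_cancel_right, dotProduct_add, dotProduct_smul]
  congr 1
  have h1 : newWeight e W' ⬝ᵥ (matH W β)⁻¹.mulVec (newWeight e W') = 2 * b - g := by
    rw [hgdef, schurShift]; ring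
  have h2 : y * g = r + newWeight e W' ⬝ᵥ (matH W β)⁻¹.mulVec v := div_mul_cancel₀ _ hg.ne'
  rw [h1, smul_eq_mul]
  linear_combination h2

theorem IsContraction.dotProduct_inv_mulVec_extend (h : IsContraction e W W') {β : κ → ℝ}
    (hH : (matH W β).PosDef) {b : ℝ} (hg : 0 < 2 * b - schurShift e W W' β) (v : κ → ℝ) (r : ℝ) :
    extend e v r ⬝ᵥ (matH W' (extend e β b))⁻¹.mulVec (extend e v r) =
      v ⬝ᵥ (matH W β)⁻¹.mulVec v +
        (r + newWeight e W' ⬝ᵥ (matH W β)⁻¹.mulVec v) ^ 2 / (2 * b - schurShift e W W' β) := by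
  rw [h.inv_mulVec_extend hH hg, extend_dotProduct_extend, dotProduct_add, dotProduct_smul,
    dotProduct_inv_mulVec_comm hH v (newWeight e W'), smul_eq_mul]
  ring

/-- The effective pinning of the additional vertex after the old vertices have been
eliminated. -/
def effPinning (e : κ ⊕ Unit ≃ ι) (W : Option κ → Option κ → ℝ) (W' : Option ι → Option ι → ℝ)
    (β : κ → ℝ) : ℝ :=
  etaV W' (e (Sum.inr ())) + newWeight e W' ⬝ᵥ (matH W β)⁻¹.mulVec (oldEta e W')

/-- The shift of `θ` at the additional vertex after the old vertices have been eliminated. -/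
def effShift (e : κ ⊕ Unit ≃ ι) (W : Option κ → Option κ → ℝ) (W' : Option ι → Option ι → ℝ)
    (x : (κ → ℝ) × (κ → ℝ)) : ℝ :=
  newWeight e W' ⬝ᵥ (matH W x.1)⁻¹.mulVec x.2

/-- Positivity of the effective pinning, which the single vertex identity needs. -/
theorem IsContraction.effPinning_pos (h : IsContraction e W W') {β : κ → ℝ}
    (hH : (matH W β).PosDef) : 0 < effPinning e W W' β := by
  -- at any admissible `b` the effective pinning is a positive multiple of `e^u` at the new vertex
  set b := (schurShift e W W' β + 1) / 2 with hb
  have hg : 2 * b - schurShift e W W' β = 1 := by rw [hb]; ring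
  have hg0 : 0 < 2 * b - schurShift e W W' β := hg ▸ one_pos
  have h1 := inv_matH_mulVec_etaV_pos h.net' ((h.posDef_iff β b).2 ⟨hH, hg0⟩) (e (Sum.inr ()))
  rwa [etaV_eq_extend (e := e), h.inv_mulVec_extend hH hg0, extend_inr, hg, div_one] at h1

/-- The density of the larger network is that of the smaller one times the density of a single
vertex. -/
theorem IsContraction.nuDensity_extend (h : IsContraction e W W') {β : κ → ℝ}
    (hH : (matH W β).PosDef) {b : ℝ} (hg : 0 < 2 * b - schurShift e W W' β) (θ : κ → ℝ) (t : ℝ) :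
    nuDensity W' (extend e β b, extend e θ t) = nuDensity W (β, θ) *
      (Real.exp (effPinning e W W' β) / (2 * Real.pi)) *
      (2 * (Real.exp (-((2 * b - schurShift e W W' β) / 2) -
        (effPinning e W W' β ^ 2 + (t + effShift e W W' (β, θ)) ^ 2) /
          (2 * (2 * b - schurShift e W W' β))) / (2 * b - schurShift e W W' β))) := by
  have hsum : ∑ i, ∑ j, matH W' (extend e β b) i j = ∑ i, ∑ j, matH W β i j -
      2 * ∑ i, newWeight e W' i + 2 * b := by
    have h1 := h.matH_mulVec_extend β (fun _ => 1) b 1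
    have h2 : ∀ i, ∑ j, matH W' (extend e β b) i j =
        (matH W' (extend e β b)).mulVec (extend e (fun _ => 1) 1) i := by
      intro i
      rw [Matrix.mulVec, dotProduct]
      refine Finset.sum_congr rfl fun j _ => ?_
      have : extend e (fun _ : κ => (1 : ℝ)) 1 j = 1 :=
        (forall_equiv_sum_unit (e := e) (p := fun j => extend e (fun _ : κ => (1 : ℝ)) 1 j = 1)).2
          ⟨fun i => by simp, by simp⟩ j
      rw [this, mul_one]
    simp only [h2]
    rw [h1, sum_equiv_sum_unit (e := e)]
    simp only [extend_inl, extend_inr, Pi.sub_apply, Pi.smul_apply, smul_eq_mul, one_mul,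
      Finset.sum_sub_distrib, dotProduct, Matrix.mulVec, mul_one]
    ring
  have heta : ∑ i, etaV W' i = ∑ i, oldEta e W' i + etaV W' (e (Sum.inr ())) :=
    sum_equiv_sum_unit _
  have hq1 := h.dotProduct_inv_mulVec_extend hH hg (oldEta e W') (etaV W' (e (Sum.inr ())))
  rw [← etaV_eq_extend] at hq1
  have hq2 := h.dotProduct_inv_mulVec_extend hH hg θ t
  have hq3 : etaV W ⬝ᵥ (matH W β)⁻¹.mulVec (etaV W) =
      oldEta e W' ⬝ᵥ (matH W β)⁻¹.mulVec (oldEta e W') +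
        2 * (newWeight e W' ⬝ᵥ (matH W β)⁻¹.mulVec (oldEta e W')) + schurShift e W W' β := by
    rw [h.etaV_eq, Matrix.mulVec_add, dotProduct_add, add_dotProduct, add_dotProduct,
      dotProduct_inv_mulVec_comm hH (oldEta e W') (newWeight e W'), schurShift]
    ring
  have hcard : Fintype.card ι = Fintype.card κ + 1 := by
    rw [← Fintype.card_congr e, Fintype.card_sum, Fintype.card_unit]
  have hdet := hH.det_pos
  unfold nuDensity
  simp only [hsum, heta, hq1, hq2, hcard, h.det_matH hH, h.etaV_eq, Pi.add_apply,
    Finset.sum_add_distrib]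
  rw [← h.etaV_eq, hq3]
  set g := 2 * b - schurShift e W W' β with hgdef
  have hb : 2 * b = g + schurShift e W W' β := by rw [hgdef]; ring
  have key : ∀ {L E a F : ℝ}, L = E + a + F →
      Real.exp L / (Real.pi ^ (Fintype.card κ + 1) * ((matH W β).det * g)) =
        Real.exp E / (Real.pi ^ Fintype.card κ * (matH W β).det) *
          (Real.exp a / (2 * Real.pi)) * (2 * (Real.exp F / g)) := by
    rintro L E a F rfl
    rw [Real.exp_add, Real.exp_add, pow_succ]
    field_simp
  refine key ?_
  rw [hb]
  simp only [effPinning, effShift]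
  ring_nf

end Schur

/-! ### Elimination of a vertex: splitting of the integral -/

section VertexPolynomial

/-- The single vertex weight times a polynomial in the complex field, as a function on the whole
plane. -/
def vertexPoly (Q : Polynomial ℂ) (a : ℝ) : ℝ × ℝ → ℂ :=
  (Set.Ioi (0 : ℝ) ×ˢ (Set.univ : Set ℝ)).indicator fun x =>
    Q.eval (((a : ℂ) + Complex.I * (x.2 : ℂ)) / (x.1 : ℂ)) *
      ((Real.exp (-(x.1 / 2) - (a ^ 2 + x.2 ^ 2) / (2 * x.1)) / x.1 : ℝ) : ℂ)

theorem vertexMeasure_eq :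
    vertexMeasure = volume.restrict (Set.Ioi (0 : ℝ) ×ˢ (Set.univ : Set ℝ)) := by
  rw [vertexMeasure, Measure.volume_eq_prod, ← Measure.prod_restrict, Measure.restrict_univ]

theorem vertexPoly_eq_sum (Q : Polynomial ℂ) (a : ℝ) :
    vertexPoly Q a = (Set.Ioi (0 : ℝ) ×ˢ (Set.univ : Set ℝ)).indicator fun x =>
      ∑ k ∈ Finset.range (Q.natDegree + 1), Q.coeff k * vertexKernel k a x := by
  unfold vertexPoly
  congr 1
  funext x
  rw [Polynomial.eval_eq_sum_range, Finset.sum_mul]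
  refine Finset.sum_congr rfl fun k _ => ?_
  rw [vertexKernel, mul_assoc]

theorem integrable_vertexPoly (Q : Polynomial ℂ) {a : ℝ} (ha : 0 < a) :
    Integrable (vertexPoly Q a) := by
  rw [vertexPoly_eq_sum, integrable_indicator_iff (measurableSet_Ioi.prod MeasurableSet.univ),
    IntegrableOn, ← vertexMeasure_eq]
  exact integrable_finsetSum _ fun k _ => (integrable_vertexKernel k ha).const_mul _

theorem integral_vertexPoly (Q : Polynomial ℂ) {a : ℝ} (ha : 0 < a) :
    ∫ x, vertexPoly Q a x = ((2 * Real.pi * Real.exp (-a) : ℝ) : ℂ) * Q.eval 1 := by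
  rw [vertexPoly_eq_sum, integral_indicator (measurableSet_Ioi.prod MeasurableSet.univ),
    ← vertexMeasure_eq, integral_finsetSum _ fun k _ => (integrable_vertexKernel k ha).const_mul _]
  simp only [integral_const_mul, integral_vertexKernel _ ha]
  rw [← Finset.sum_mul, Polynomial.eval_eq_sum_range, mul_comm]
  simp

theorem integral_comp_affine {f : ℝ × ℝ → ℂ} (hf : Integrable f) {γ m : ℝ}
    (hf' : Integrable fun z : ℝ × ℝ => f (2 * z.1 - γ, z.2 + m)) :
    ∫ z : ℝ × ℝ, f (2 * z.1 - γ, z.2 + m) = (1 / 2 : ℝ) • ∫ z, f z := by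
  rw [Measure.volume_eq_prod] at hf hf' ⊢
  rw [integral_prod _ hf', integral_prod _ hf]
  have h1 : ∀ b : ℝ, ∫ t, f (2 * b - γ, t + m) = ∫ t, f (2 * b - γ, t) := fun b =>
    integral_add_right_eq_self (fun t => f (2 * b - γ, t)) m
  simp only [h1]
  rw [Measure.integral_comp_mul_left (fun g => ∫ t, f (g - γ, t)) 2,
    integral_sub_right_eq_self (fun g => ∫ t, f (g, t)) γ]
  norm_num

end VertexPolynomial

section Splitting
variable {ι κ : Type*} [Fintype ι] [Fintype κ]

theorem measurePreserving_extend (e : κ ⊕ Unit ≃ ι) :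
    MeasurePreserving (fun x : (κ → ℝ) × ℝ => extend e x.1 x.2) volume volume := by
  have hm : Measurable fun x : (κ → ℝ) × ℝ => extend e x.1 x.2 := by
    refine measurable_pi_lambda _ ((forall_equiv_sum_unit (e := e)).2 ⟨fun i => ?_, ?_⟩)
    · simp only [extend_inl]
      fun_prop
    · simp only [extend_inr]
      fun_prop
  refine ⟨hm, ?_⟩
  rw [volume_pi]
  refine (Measure.pi_eq fun s hs => ?_).symm
  rw [Measure.map_apply hm (MeasurableSet.univ_pi hs)]
  have hpre : (fun x : (κ → ℝ) × ℝ => extend e x.1 x.2) ⁻¹' Set.univ.pi s =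
      (Set.univ.pi fun i => s (e (Sum.inl i))) ×ˢ s (e (Sum.inr ())) := by
    ext x
    simp only [Set.mem_preimage, Set.mem_univ_pi, Set.mem_prod]
    rw [forall_equiv_sum_unit (e := e)]
    simp
  rw [hpre, Measure.volume_eq_prod, Measure.prod_prod, volume_pi_pi, ← e.prod_comp,
    Fintype.prod_sum_type]
  simp

/-- The variables of a network split into those of the old vertices and those of the additional
vertex. -/
def splitMap (e : κ ⊕ Unit ≃ ι) (z : ((κ → ℝ) × (κ → ℝ)) × (ℝ × ℝ)) : (ι → ℝ) × (ι → ℝ) :=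
  (extend e z.1.1 z.2.1, extend e z.1.2 z.2.2)

theorem measurePreserving_prodProdProdComm {α β γ δ : Type*} [MeasureSpace α] [MeasureSpace β]
    [MeasureSpace γ] [MeasureSpace δ] [SFinite (volume : Measure α)] [SFinite (volume : Measure β)]
    [SFinite (volume : Measure γ)] [SFinite (volume : Measure δ)] :
    MeasurePreserving (fun z : (α × β) × (γ × δ) => ((z.1.1, z.2.1), (z.1.2, z.2.2)))
      volume volume := by
  have hm : Measurable fun z : (α × β) × (γ × δ) => ((z.1.1, z.2.1), (z.1.2, z.2.2)) := by
    fun_prop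
  refine ⟨hm, Measure.ext_of_lintegral _ fun f hf => ?_⟩
  rw [lintegral_map hf hm]
  simp only [Measure.volume_eq_prod]
  rw [lintegral_prod (fun z : (α × β) × (γ × δ) => f ((z.1.1, z.2.1), (z.1.2, z.2.2)))
      (by fun_prop), lintegral_prod f hf.aemeasurable,
    lintegral_prod (fun x : α × β => ∫⁻ y : γ × δ, f ((x.1, y.1), (x.2, y.2))
      ∂(volume.prod volume)) ?_,
    lintegral_prod (fun x : α × γ => ∫⁻ y : β × δ, f (x, y) ∂(volume.prod volume)) ?_]
  rotate_left
  · exact (Measurable.lintegral_prod_right' (f := fun z : (α × γ) × (β × δ) => f z)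
      hf).aemeasurable
  · exact (Measurable.lintegral_prod_right' (f := fun z : (α × β) × (γ × δ) =>
      f ((z.1.1, z.2.1), (z.1.2, z.2.2))) (hf.comp hm)).aemeasurable
  refine lintegral_congr fun a => ?_
  have h1 : ∀ b, ∫⁻ y : γ × δ, f ((a, y.1), (b, y.2)) ∂(volume.prod volume) =
      ∫⁻ c, ∫⁻ d, f ((a, c), (b, d)) := fun b => lintegral_prod _ (by fun_prop)
  have h2 : ∀ c, ∫⁻ y : β × δ, f ((a, c), y) ∂(volume.prod volume) =
      ∫⁻ b, ∫⁻ d, f ((a, c), (b, d)) := fun c => lintegral_prod _ (by fun_prop)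
  simp only [h1, h2]
  exact lintegral_lintegral_swap (by fun_prop)

theorem measurePreserving_splitMap (e : κ ⊕ Unit ≃ ι) :
    MeasurePreserving (splitMap e) volume volume :=
  ((measurePreserving_extend e).prod (measurePreserving_extend e)).comp
    measurePreserving_prodProdProdComm

end Splitting

/-! ### Elimination of a vertex: the conditional expectation -/

section ContractionField
variable {ι κ : Type*} {e : κ ⊕ Unit ≃ ι}

/-- The vertex map of the contraction. -/
def contractVertex (e : κ ⊕ Unit ≃ ι) : Option ι → Option κ
  | none => none
  | some i => Sum.elim some (fun _ => none) (e.symm i)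

/-- Restriction of the variables to the old vertices. -/
def restrictOld (e : κ ⊕ Unit ≃ ι) (x : (ι → ℝ) × (ι → ℝ)) : (κ → ℝ) × (κ → ℝ) :=
  (fun i => x.1 (e (Sum.inl i)), fun i => x.2 (e (Sum.inl i)))

theorem measurable_restrictOld (e : κ ⊕ Unit ≃ ι) : Measurable (restrictOld e) := by
  unfold restrictOld
  fun_prop

theorem restrictOld_splitMap (z : ((κ → ℝ) × (κ → ℝ)) × (ℝ × ℝ)) :
    restrictOld e (splitMap e z) = z.1 := by
  simp [restrictOld, splitMap]

variable [Fintype κ] [DecidableEq κ]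
variable {W : Option κ → Option κ → ℝ} {W' : Option ι → Option ι → ℝ}

/-- The complex field at the vertex `j`, given the variables of the old vertices, as a polynomial
in the complex field at the additional vertex. -/
def fieldPoly (e : κ ⊕ Unit ≃ ι) (W : Option κ → Option κ → ℝ) (W' : Option ι → Option ι → ℝ)
    (x : (κ → ℝ) × (κ → ℝ)) : Option ι → Polynomial ℂ
  | none => 1
  | some i => Sum.elim (fun k =>
      Polynomial.C ((((matH W x.1)⁻¹.mulVec (oldEta e W') k : ℝ) : ℂ) +
        Complex.I * (((matH W x.1)⁻¹.mulVec x.2 k : ℝ) : ℂ)) +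
      Polynomial.C (((matH W x.1)⁻¹.mulVec (newWeight e W') k : ℝ) : ℂ) * Polynomial.X)
      (fun _ => Polynomial.X) (e.symm i)

/-- The field of the smaller network is the value at `1`, the field at the pinned vertex. -/
theorem IsContraction.field_contractVertex (h : IsContraction e W W') (x : (κ → ℝ) × (κ → ℝ))
    (j : Option ι) : field W x (contractVertex e j) = (fieldPoly e W W' x j).eval 1 := by
  cases j with
  | none => simp [field, contractVertex, fieldPoly]
  | some i =>
    refine (forall_equiv_sum_unit (e := e) (p := fun i => field W x (contractVertex e (some i)) =
      (fieldPoly e W W' x (some i)).eval 1)).2 ⟨fun i => ?_, ?_⟩ i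
    · simp only [contractVertex, fieldPoly, Equiv.symm_apply_apply, Sum.elim_inl, field,
        Polynomial.eval_add, Polynomial.eval_mul, Polynomial.eval_C, Polynomial.eval_X, h.etaV_eq,
        Matrix.mulVec_add, Pi.add_apply, Complex.ofReal_add]
      ring
    · simp [contractVertex, fieldPoly, field]

end ContractionField

section Elimination
variable {ι κ : Type*} [Fintype ι] [DecidableEq ι] [Fintype κ] [DecidableEq κ]
variable {e : κ ⊕ Unit ≃ ι} {W : Option κ → Option κ → ℝ} {W' : Option ι → Option ι → ℝ}

theorem nuDensity_pos {x : (κ → ℝ) × (κ → ℝ)} (hx : (matH W x.1).PosDef) :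
    0 < nuDensity W x :=
  div_pos (Real.exp_pos _) (mul_pos (pow_pos Real.pi_pos _) hx.det_pos)

/-- The density of `nu`, extended by zero outside of the domain of positive definiteness. -/
def nuDensity₀ (W : Option κ → Option κ → ℝ) : (κ → ℝ) × (κ → ℝ) → ℝ :=
  {x | (matH W x.1).PosDef}.indicator (nuDensity W)

theorem nuDensity₀_of_posDef {x : (κ → ℝ) × (κ → ℝ)} (hx : (matH W x.1).PosDef) :
    nuDensity₀ W x = nuDensity W x := by
  simp [nuDensity₀, Set.indicator, hx]

theorem nuDensity₀_of_not_posDef {x : (κ → ℝ) × (κ → ℝ)} (hx : ¬ (matH W x.1).PosDef) :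
    nuDensity₀ W x = 0 := by
  simp [nuDensity₀, Set.indicator, hx]

theorem measurable_ofReal_nuDensity (hW : IsNetwork W) :
    Measurable ({x : (κ → ℝ) × (κ → ℝ) | (matH W x.1).PosDef}.indicator
      fun x => ENNReal.ofReal (nuDensity W x)) :=
  (measurable_nuDensity W).ennreal_ofReal.indicator (measurable_fst (measurableSet_posDef_matH hW))

theorem toReal_nuDensity (x : (κ → ℝ) × (κ → ℝ)) :
    ({x : (κ → ℝ) × (κ → ℝ) | (matH W x.1).PosDef}.indicator
      (fun x => ENNReal.ofReal (nuDensity W x)) x).toReal = nuDensity₀ W x := by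
  by_cases hx : (matH W x.1).PosDef
  · simp [nuDensity₀, Set.indicator, hx, (nuDensity_pos hx).le]
  · simp [nuDensity₀, Set.indicator, hx]

theorem ofReal_nuDensity_lt_top (x : (κ → ℝ) × (κ → ℝ)) :
    {x : (κ → ℝ) × (κ → ℝ) | (matH W x.1).PosDef}.indicator
      (fun x => ENNReal.ofReal (nuDensity W x)) x < ⊤ := by
  by_cases hx : (matH W x.1).PosDef <;> simp [Set.indicator, hx]

theorem setIntegral_nu (hW : IsNetwork W) {S : Set ((κ → ℝ) × (κ → ℝ))} (hS : MeasurableSet S)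
    (f : (κ → ℝ) × (κ → ℝ) → ℂ) :
    ∫ x in S, f x ∂nu W = ∫ x, S.indicator (fun x => nuDensity₀ W x • f x) x := by
  rw [nu, setIntegral_withDensity_eq_setIntegral_toReal_smul (measurable_ofReal_nuDensity hW)
    (Filter.Eventually.of_forall ofReal_nuDensity_lt_top) f hS, integral_indicator hS]
  simp only [toReal_nuDensity]

theorem integrable_nu_iff (hW : IsNetwork W) {f : (κ → ℝ) × (κ → ℝ) → ℂ} :
    Integrable f (nu W) ↔ Integrable fun x => nuDensity₀ W x • f x := by
  rw [nu, integrable_withDensity_iff_integrable_smul' (measurable_ofReal_nuDensity hW)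
    (Filter.Eventually.of_forall ofReal_nuDensity_lt_top)]
  simp only [toReal_nuDensity]

theorem IsContraction.field_splitMap (h : IsContraction e W W') {x : (κ → ℝ) × (κ → ℝ)}
    (hH : (matH W x.1).PosDef) {b : ℝ} (hg : 0 < 2 * b - schurShift e W W' x.1) (t : ℝ)
    (j : Option ι) :
    field W' (splitMap e (x, (b, t))) j = (fieldPoly e W W' x j).eval
      (((effPinning e W W' x.1 : ℂ) + Complex.I * ((t + effShift e W W' x : ℝ) : ℂ)) /
        ((2 * b - schurShift e W W' x.1 : ℝ) : ℂ)) := by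
  cases j with
  | none => simp [field, fieldPoly]
  | some i =>
    have h1 := h.inv_mulVec_extend hH hg (oldEta e W') (etaV W' (e (Sum.inr ())))
    rw [← etaV_eq_extend] at h1
    have h2 := h.inv_mulVec_extend hH hg x.2 t
    set y := (((effPinning e W W' x.1 : ℂ) + Complex.I * ((t + effShift e W W' x : ℝ) : ℂ)) /
        ((2 * b - schurShift e W W' x.1 : ℝ) : ℂ)) with hy
    have hy' : y = ((effPinning e W W' x.1 / (2 * b - schurShift e W W' x.1) : ℝ) : ℂ) +
        Complex.I * (((t + effShift e W W' x) / (2 * b - schurShift e W W' x.1) : ℝ) : ℂ) := by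
      rw [hy]
      push_cast
      ring
    refine (forall_equiv_sum_unit (e := e) (p := fun i => field W' (splitMap e (x, (b, t)))
      (some i) = (fieldPoly e W W' x (some i)).eval y)).2 ⟨fun i => ?_, ?_⟩ i
    · simp only [field, splitMap, h1, h2, extend_inl, fieldPoly, Equiv.symm_apply_apply,
        Sum.elim_inl, Polynomial.eval_add, Polynomial.eval_mul, Polynomial.eval_C,
        Polynomial.eval_X, hy', Pi.add_apply, Pi.smul_apply, smul_eq_mul, effPinning, effShift]
      push_cast
      ring
    · simp only [field, splitMap, h1, h2, extend_inr, fieldPoly, Equiv.symm_apply_apply,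
        Sum.elim_inr, Polynomial.eval_X, hy', effPinning, effShift]

/-- Conditionally on the variables of the old vertices, the complex field at the additional vertex
has the law of a single vertex with pinning `effPinning`. -/
theorem IsContraction.integrand_splitMap (h : IsContraction e W W') {x : (κ → ℝ) × (κ → ℝ)}
    (hH : (matH W x.1).PosDef) (k : ℕ) (j : Fin k → Option ι) (z : ℝ × ℝ) :
    nuDensity₀ W' (splitMap e (x, z)) • ∏ l, field W' (splitMap e (x, z)) (j l) =
      ((nuDensity W x * (Real.exp (effPinning e W W' x.1) / Real.pi) : ℝ) : ℂ) *
        vertexPoly (∏ l, fieldPoly e W W' x (j l)) (effPinning e W W' x.1)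
          (2 * z.1 - schurShift e W W' x.1, z.2 + effShift e W W' x) := by
  obtain ⟨b, t⟩ := z
  have hiff := h.posDef_iff x.1 b
  by_cases hg : 0 < 2 * b - schurShift e W W' x.1
  · have hpd : (matH W' (splitMap e (x, (b, t))).1).PosDef := hiff.2 ⟨hH, hg⟩
    have h1 := nuDensity₀_of_posDef hpd
    have hmem : (2 * b - schurShift e W W' x.1, t + effShift e W W' x) ∈
        Set.Ioi (0 : ℝ) ×ˢ (Set.univ : Set ℝ) := ⟨hg, Set.mem_univ _⟩
    rw [h1, vertexPoly, Set.indicator_of_mem hmem]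
    simp only [h.field_splitMap hH hg]
    rw [show nuDensity W' (splitMap e (x, (b, t))) =
      nuDensity W' (extend e x.1 b, extend e x.2 t) from rfl, h.nuDensity_extend hH hg,
      Polynomial.eval_prod, Complex.real_smul]
    push_cast
    ring
  · have hpd : ¬ (matH W' (splitMap e (x, (b, t))).1).PosDef := fun hp => hg (hiff.1 hp).2
    have h1 := nuDensity₀_of_not_posDef hpd
    have hmem : (2 * b - schurShift e W W' x.1, t + effShift e W W' x) ∉
        Set.Ioi (0 : ℝ) ×ˢ (Set.univ : Set ℝ) := fun hp => hg hp.1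
    rw [h1, vertexPoly, Set.indicator_of_notMem hmem, zero_smul, mul_zero]

/-- The martingale property for the elimination of one vertex. -/
theorem IsContraction.setIntegral_prod_field (h : IsContraction e W W') (k : ℕ)
    (j : Fin k → Option ι) {B : Set ((κ → ℝ) × (κ → ℝ))} (hB : MeasurableSet B) :
    ∫ x in restrictOld e ⁻¹' B, ∏ l, field W' x (j l) ∂nu W' =
      ∫ x in B, ∏ l, field W x (contractVertex e (j l)) ∂nu W := by
  have hS : MeasurableSet (restrictOld e ⁻¹' B) := measurable_restrictOld e hB
  rw [setIntegral_nu h.net' hS, setIntegral_nu h.net hB]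
  set G : (ι → ℝ) × (ι → ℝ) → ℂ := (restrictOld e ⁻¹' B).indicator
    fun x => nuDensity₀ W' x • ∏ l, field W' x (j l) with hG
  have hGint : Integrable G :=
    ((integrable_nu_iff h.net').1 (integrable_prod_field h.net' k j)).indicator hS
  have hmp := measurePreserving_splitMap e
  have hGint' : Integrable (G ∘ splitMap e) := hmp.integrable_comp_of_integrable hGint
  have h1 : ∫ x, G x = ∫ z, (G ∘ splitMap e) z := by
    conv_lhs => rw [← hmp.map_eq]
    exact integral_map hmp.aemeasurable (by rw [hmp.map_eq]; exact hGint.aestronglyMeasurable)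
  rw [h1]
  rw [Measure.volume_eq_prod] at hGint' ⊢
  rw [integral_prod _ hGint']
  refine integral_congr_ae ?_
  filter_upwards [hGint'.prod_right_ae] with x hx
  have hmem : ∀ z, splitMap e (x, z) ∈ restrictOld e ⁻¹' B ↔ x ∈ B := fun z => by
    rw [Set.mem_preimage, restrictOld_splitMap]
  simp only [Function.comp_apply] at hx ⊢
  by_cases hxB : x ∈ B
  swap
  · have hz : ∀ z, G (splitMap e (x, z)) = 0 := fun z =>
      Set.indicator_of_notMem (fun hp => hxB ((hmem z).1 hp)) _
    simp only [hz]
    rw [integral_zero, Set.indicator_of_notMem hxB]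
  have hz : ∀ z, G (splitMap e (x, z)) = nuDensity₀ W' (splitMap e (x, z)) •
      ∏ l, field W' (splitMap e (x, z)) (j l) := fun z =>
    Set.indicator_of_mem ((hmem z).2 hxB) _
  rw [Set.indicator_of_mem hxB]
  by_cases hH : (matH W x.1).PosDef
  swap
  · have h2 : ∀ z, nuDensity₀ W' (splitMap e (x, z)) = 0 := fun z =>
      nuDensity₀_of_not_posDef fun hp => hH ((h.posDef_iff x.1 z.1).1 hp).1
    simp only [hz, h2, zero_smul, integral_zero, nuDensity₀_of_not_posDef hH]
  · have hpos := nuDensity_pos hH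
    have ha := h.effPinning_pos hH
    have hint : ∀ z, G (splitMap e (x, z)) = _ := fun z =>
      (hz z).trans (h.integrand_splitMap hH k j z)
    set c := nuDensity W x * (Real.exp (effPinning e W W' x.1) / Real.pi) with hcdef
    have hc : (c : ℂ) ≠ 0 := by
      rw [Complex.ofReal_ne_zero, hcdef]
      positivity
    have hx' := (integrable_congr (Filter.Eventually.of_forall hint)).1 hx
    rw [integrable_const_mul_iff (IsUnit.mk0 _ hc)] at hx'
    rw [integral_congr_ae (Filter.Eventually.of_forall hint), integral_const_mul,
      integral_comp_affine (integrable_vertexPoly _ ha) hx',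
      integral_vertexPoly _ ha, nuDensity₀_of_posDef hH, Polynomial.eval_prod]
    simp only [h.field_contractVertex]
    rw [Complex.real_smul, Complex.real_smul, ← mul_assoc, ← mul_assoc, ← Complex.ofReal_mul,
      ← Complex.ofReal_mul]
    congr 2
    rw [hcdef, Real.exp_neg]
    field_simp

end Elimination

/-! ### Wired networks and the martingales -/

section Wired
variable {V : Type*} {G : SimpleGraph V} {W : V → V → ℝ} {S T : Finset V}

/-- Every nonempty subset of `S` has an edge to its complement. This is the connectivity of the
wired graph, in a form which is inherited by subsets. -/
def HasExits (G : SimpleGraph V) (S : Finset V) : Prop :=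
  ∀ Z : Set V, Z ⊆ S → Z.Nonempty → ∃ i ∈ Z, ∃ j, j ∉ Z ∧ G.Adj i j

theorem HasExits.mono (hT : HasExits G T) (h : S ⊆ T) : HasExits G S :=
  fun Z hZ => hT Z (hZ.trans (Finset.coe_subset.2 h))

theorem hasExits_of_connected (h : (wiredGraph G S).Connected) : HasExits G S := by
  rintro Z hZ ⟨i, hi⟩
  by_contra! hcon
  have key : ∀ {a b : Option S}, (wiredGraph G S).Walk a b →
      (∃ z : S, (z : V) ∈ Z ∧ a = some z) → ∃ z : S, (z : V) ∈ Z ∧ b = some z := by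
    intro a b p
    induction p with
    | nil => exact id
    | @cons a c b hadj _ ih =>
      rintro ⟨z, hz, rfl⟩
      refine ih ?_
      cases c with
      | none =>
        obtain ⟨j, hj, hzj⟩ : ∃ j, j ∉ S ∧ G.Adj z j := hadj
        exact absurd hzj (hcon z hz j fun hjZ => hj (hZ hjZ))
      | some c =>
        have hzc : G.Adj z c := hadj
        by_cases hc : (c : V) ∈ Z
        · exact ⟨c, hc, rfl⟩
        · exact absurd hzc (hcon z hz c hc)
  obtain ⟨p⟩ := h.preconnected (some ⟨i, hZ hi⟩) none
  obtain ⟨z, _, hz⟩ := key p ⟨⟨i, hZ hi⟩, hi, rfl⟩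
  exact Option.some_ne_none z hz.symm

/-- An exit of a set `Z` to a vertex outside of `S` becomes an edge to `δ`, whose weight is positive
because one of the summands is. -/
theorem isNetwork_wiredWeight (hsymm : ∀ i j, W i j = W j i)
    (hpos : ∀ i j, G.Adj i j → 0 < W i j) (hzero : ∀ i j, ¬ G.Adj i j → W i j = 0)
    (hsum : ∀ i, Summable fun j => W i j) (hS : HasExits G S) :
    IsNetwork (wiredWeight W S) := by
  have hnn : ∀ i j, 0 ≤ W i j := fun i j => by
    by_cases h : G.Adj i j
    · exact (hpos i j h).le
    · exact (hzero i j h).ge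
  refine ⟨?_, ?_, ?_, ?_⟩
  · rintro (_ | i) (_ | j)
    · rfl
    · rfl
    · rfl
    · exact hsymm i j
  · rintro (_ | i) (_ | j)
    · exact le_rfl
    · exact tsum_nonneg fun _ => hnn _ _
    · exact tsum_nonneg fun _ => hnn _ _
    · exact hnn i j
  · rintro (_ | i)
    · rfl
    · exact hzero _ _ (G.loopless.irrefl _)
  · rintro Z ⟨z, hz⟩
    obtain ⟨i, ⟨i, hi, rfl⟩, j, hj, hij⟩ := hS (Subtype.val '' Z)
      (by rintro _ ⟨y, _, rfl⟩; exact y.2) ⟨z, z, hz, rfl⟩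
    refine ⟨i, hi, ?_⟩
    by_cases hjS : j ∈ S
    · refine ⟨some ⟨j, hjS⟩, ?_, hpos _ _ hij⟩
      rintro y hy hyj
      exact hj ⟨y, hy, by rw [← Option.some_injective _ hyj]⟩
    · refine ⟨none, fun _ _ => by simp, ?_⟩
      have hs : Summable fun j : {j : V // j ∉ S} => W i j := (hsum i).subtype _
      exact hs.tsum_pos (fun _ => hnn _ _) ⟨j, hjS⟩ (hpos _ _ hij)

/-- Restriction of the variables from `T` to `S ⊆ T`. -/
def restrictTo (h : S ⊆ T) (x : (T → ℝ) × (T → ℝ)) : (S → ℝ) × (S → ℝ) :=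
  (fun i => x.1 ⟨i, h i.2⟩, fun i => x.2 ⟨i, h i.2⟩)

theorem measurable_restrictTo (h : S ⊆ T) : Measurable (restrictTo h) := by
  unfold restrictTo
  fun_prop

variable [DecidableEq V]

/-- The vertices of `insert x S`, split into those of `S` and `x`. -/
def insertEquiv {x : V} (hx : x ∉ S) : S ⊕ Unit ≃ (insert x S : Finset V) :=
  Equiv.ofBijective
    (Sum.elim (fun i => ⟨i, Finset.mem_insert_of_mem i.2⟩)
      fun _ => ⟨x, Finset.mem_insert_self x S⟩) (by
    constructor
    · rintro (i | i) (j | j) h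
      · have h : (⟨i, Finset.mem_insert_of_mem i.2⟩ : (insert x S : Finset V)) =
          ⟨j, Finset.mem_insert_of_mem j.2⟩ := h
        rw [Subtype.ext (Subtype.mk.inj h)]
      · have h : (i : V) = x := congrArg Subtype.val h
        exact absurd (h ▸ i.2) hx
      · have h : x = (j : V) := congrArg Subtype.val h
        exact absurd (h ▸ j.2) hx
      · rfl
    · rintro ⟨y, hy⟩
      by_cases h : y ∈ S
      · exact ⟨Sum.inl ⟨y, h⟩, rfl⟩
      · exact ⟨Sum.inr (), Subtype.ext ((Finset.mem_insert.1 hy).resolve_right h).symm⟩)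

/-- Merging `x` with `δ` splits off the summand `W_{ix}` from the weight of the edge to `δ`. -/
theorem isContraction_insert (hsymm : ∀ i j, W i j = W j i)
    (hpos : ∀ i j, G.Adj i j → 0 < W i j) (hzero : ∀ i j, ¬ G.Adj i j → W i j = 0)
    (hsum : ∀ i, Summable fun j => W i j) {x : V} (hx : x ∉ S) (hS : HasExits G (insert x S)) :
    IsContraction (insertEquiv hx) (wiredWeight W S) (wiredWeight W (insert x S)) where
  net := isNetwork_wiredWeight hsymm hpos hzero hsum (hS.mono (Finset.subset_insert x S))
  net' := isNetwork_wiredWeight hsymm hpos hzero hsum hS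
  inner _ _ := rfl
  boundary i := by
    change ∑' j : {j : V // j ∉ S}, W i j =
      ∑' j : {j : V // j ∉ insert x S}, W i j + W i x
    have hs : ∀ T : Finset V, Summable ((↑T : Set V)ᶜ.indicator fun j => W i j) := fun T =>
      (hsum i).indicator _
    have e : ∀ T : Finset V, ∑' j : {j : V // j ∉ T}, W i j =
        ∑' j, (↑T : Set V)ᶜ.indicator (fun j => W i j) j := fun T =>
      tsum_subtype ((↑T : Set V)ᶜ) fun j => W i j
    rw [e, e, ← tsum_ite_eq x fun _ => W i x,
      ← (hs _).tsum_add (hasSum_ite_eq x (W i x)).summable]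
    refine tsum_congr fun j => ?_
    by_cases hj : j = x
    · subst hj
      simp [hx]
    · by_cases hjS : j ∈ S <;> simp [hj, hjS]

/-- The vertex `j` of the infinite graph as a vertex of the wired graph; the vertices outside of
`S` are merged into `δ`. -/
def wiredVertex (S : Finset V) (j : V) : Option S := if h : j ∈ S then some ⟨j, h⟩ else none

theorem contractVertex_wiredVertex {x : V} (hx : x ∉ S) (j : V) :
    contractVertex (insertEquiv hx) (wiredVertex (insert x S) j) = wiredVertex S j := by
  by_cases hj : j ∈ S
  · have h1 : wiredVertex (insert x S) j = some (insertEquiv hx (Sum.inl ⟨j, hj⟩)) := by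
      simp only [wiredVertex, Finset.mem_insert_of_mem hj, dif_pos]
      rfl
    rw [h1]
    simp [contractVertex, wiredVertex, hj]
  · by_cases hjx : j = x
    · subst hjx
      have h1 : wiredVertex (insert j S) j = some (insertEquiv hx (Sum.inr ())) := by
        simp only [wiredVertex, Finset.mem_insert_self, dif_pos]
        rfl
      rw [h1]
      simp [contractVertex, wiredVertex, hj]
    · simp [contractVertex, wiredVertex, hj, hjx]

/-- The martingale property on the level of the laws of `(β, θ)`, by successive elimination of the
vertices of `T \ S`. -/
theorem setIntegral_prod_field_wired (hsymm : ∀ i j, W i j = W j i)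
    (hpos : ∀ i j, G.Adj i j → 0 < W i j) (hzero : ∀ i j, ¬ G.Adj i j → W i j = 0)
    (hsum : ∀ i, Summable fun j => W i j) {k : ℕ} (j : Fin k → V) (h : S ⊆ T)
    (hT : HasExits G T) {B : Set ((S → ℝ) × (S → ℝ))} (hB : MeasurableSet B) :
    ∫ x in restrictTo h ⁻¹' B, ∏ l, field (wiredWeight W T) x (wiredVertex T (j l))
        ∂nu (wiredWeight W T) =
      ∫ x in B, ∏ l, field (wiredWeight W S) x (wiredVertex S (j l)) ∂nu (wiredWeight W S) := by
  induction hn : (T \ S).card generalizing T with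
  | zero =>
    obtain rfl : S = T :=
      h.antisymm (Finset.sdiff_eq_empty_iff_subset.1 (Finset.card_eq_zero.1 hn))
    rfl
  | succ n ih =>
    obtain ⟨x, hx⟩ : (T \ S).Nonempty := Finset.card_pos.1 (by omega)
    obtain ⟨hxT, hxS⟩ := Finset.mem_sdiff.1 hx
    obtain ⟨T', hxT', rfl⟩ : ∃ T', x ∉ T' ∧ T = insert x T' :=
      ⟨T.erase x, Finset.notMem_erase x T, (Finset.insert_erase hxT).symm⟩
    have h' : S ⊆ T' := (Finset.subset_insert_iff_of_notMem hxS).1 h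
    have hcard : (T' \ S).card = n := by
      rw [Finset.insert_sdiff_of_notMem _ hxS, Finset.card_insert_of_notMem
        (fun hm => hxT' (Finset.mem_sdiff.1 hm).1)] at hn
      omega
    rw [← ih h' (hT.mono (Finset.subset_insert x T')) hcard]
    have hc := isContraction_insert hsymm hpos hzero hsum hxT' hT
    have h1 := hc.setIntegral_prod_field k (fun l => wiredVertex (insert x T') (j l))
      (measurable_restrictTo h' hB)
    simp only [contractVertex_wiredVertex] at h1
    exact h1

end Wired

section MartingaleProperty
variable {V : Type*} [DecidableEq V] {G : SimpleGraph V} {W : V → V → ℝ}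
variable {Ω : Type*} {S : Finset V} {β θ : V → Ω → ℝ}

theorem ae_nu_posDef {ι : Type*} [Fintype ι] [DecidableEq ι] {W : Option ι → Option ι → ℝ}
    (hW : IsNetwork W) : ∀ᵐ x ∂nu W, (matH W x.1).PosDef := by
  rw [nu, ae_withDensity_iff (measurable_ofReal_nuDensity hW)]
  refine Filter.Eventually.of_forall fun x hx => ?_
  by_contra h
  exact hx (by simp [Set.indicator, h])

/-- The process `M` as a function of the variables `(β, θ)` on `S`. -/
def prodMFun (W : V → V → ℝ) (S : Finset V) {k : ℕ} (j : Fin k → V)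
    (x : (S → ℝ) × (S → ℝ)) : ℂ :=
  ∏ l, (Real.exp (uOfBeta (wiredWeight W S) x.1 (wiredVertex S (j l))) : ℂ) *
    (1 + Complex.I * (sOfBetaTheta (wiredWeight W S) x.1 x.2 (wiredVertex S (j l)) : ℂ))

theorem prodM_eq {k : ℕ} (j : Fin k → V) (ω : Ω) :
    prodM W S β θ j ω = prodMFun W S j (restr S β θ ω) := by
  refine Finset.prod_congr rfl fun l _ => ?_
  by_cases h : j l ∈ S
  · simp [uField, sField, wiredVertex, h]
  · simp [uField, sField, wiredVertex, h, uOfBeta, sOfBetaTheta, pin]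

theorem measurable_prodMFun {k : ℕ} (j : Fin k → V) : Measurable (prodMFun W S j) := by
  refine Finset.measurable_prod _ fun l _ => ?_
  have h1 : Measurable fun x : (S → ℝ) × (S → ℝ) =>
      uOfBeta (wiredWeight W S) x.1 (wiredVertex S (j l)) :=
    (measurable_pi_apply _).comp ((measurable_uOfBeta _).comp measurable_fst)
  have h2 : Measurable fun x : (S → ℝ) × (S → ℝ) =>
      sOfBetaTheta (wiredWeight W S) x.1 x.2 (wiredVertex S (j l)) :=
    (measurable_pi_apply _).comp (measurable_sOfBetaTheta _)
  fun_prop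

/-- The maps `f` and `g` reproduce the complex field only where `H_β` is positive definite, which is
almost everywhere. -/
theorem prodMFun_ae_eq (hW : IsNetwork (wiredWeight W S)) {k : ℕ} (j : Fin k → V) :
    prodMFun W S j =ᵐ[nu (wiredWeight W S)]
      fun x => ∏ l, field (wiredWeight W S) x (wiredVertex S (j l)) := by
  filter_upwards [ae_nu_posDef hW] with x hx
  exact Finset.prod_congr rfl fun l _ => (field_eq hW hx x.2 _).symm

theorem martingale_comp_continuousLinearMap {Ω E F ι : Type*} [Preorder ι] {m : MeasurableSpace Ω}
    {P : Measure Ω} [NormedAddCommGroup E] [NormedSpace ℝ E] [CompleteSpace E]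
    [NormedAddCommGroup F] [NormedSpace ℝ F] [CompleteSpace F] {ℱ : Filtration ι m}
    {f : ι → Ω → E} (hf : Martingale f ℱ P) (L : E →L[ℝ] F) :
    Martingale (fun n ω => L (f n ω)) ℱ P := by
  refine ⟨fun n => L.continuous.comp_stronglyMeasurable (hf.1 n), fun i j hij => ?_⟩
  refine (L.comp_condExp_comm (m := ℱ i) (hf.integrable j)).symm.trans ?_
  filter_upwards [hf.2 i j hij] with ω hω
  simp only [Function.comp_apply, hω]

variable [MeasurableSpace Ω]

/-- Sets in `F_n` are preimages of sets in the coordinates on `V_n`, so that the defining property of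
the conditional expectation is an identity between integrals over the laws `nu`. -/
theorem martingale_prodM (hsymm : ∀ i j, W i j = W j i)
    (hpos : ∀ i j, G.Adj i j → 0 < W i j) (hzero : ∀ i j, ¬ G.Adj i j → W i j = 0)
    (hsum : ∀ i, Summable fun j => W i j) (Vn : ℕ → Finset V) (hmono : Monotone Vn)
    (hconn : ∀ n, (wiredGraph G (Vn n)).Connected) (P : Measure Ω) [IsProbabilityMeasure P]
    (hβ : ∀ i, Measurable (β i)) (hθ : ∀ i, Measurable (θ i))
    (hlaw : HasInfiniteVolumeLaw W Vn P β θ) {k : ℕ} (j : Fin k → V) :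
    Martingale (fun n ω => prodM W (Vn n) β θ j ω) (filt Vn hmono β θ hβ hθ) P := by
  have hex : ∀ n, HasExits G (Vn n) := fun n => hasExits_of_connected (hconn n)
  have hnet : ∀ n, IsNetwork (wiredWeight W (Vn n)) := fun n =>
    isNetwork_wiredWeight hsymm hpos hzero hsum (hex n)
  have hr : ∀ n, Measurable (restr (Vn n) β θ) := fun n => measurable_restr _ β θ hβ hθ
  have hmap : ∀ n, P.map (restr (Vn n) β θ) = nu (wiredWeight W (Vn n)) := fun n => by
    rw [hlaw n, map_mu (hnet n)]
  have hM : ∀ n, (fun ω => prodM W (Vn n) β θ j ω) = prodMFun W (Vn n) j ∘ restr (Vn n) β θ :=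
    fun n => funext fun ω => prodM_eq j ω
  have hadapt : ∀ n, StronglyMeasurable[filt Vn hmono β θ hβ hθ n]
      fun ω => prodM W (Vn n) β θ j ω := by
    intro n
    rw [hM]
    exact ((measurable_prodMFun j).comp (comap_measurable (restr (Vn n) β θ))).stronglyMeasurable
  have hint : ∀ n, Integrable (fun ω => prodM W (Vn n) β θ j ω) P := by
    intro n
    rw [hM, ← integrable_map_measure (measurable_prodMFun j).aestronglyMeasurable
      (hr n).aemeasurable, hmap, integrable_congr (prodMFun_ae_eq (hnet n) j)]
    exact integrable_prod_field (hnet n) k _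
  have hset : ∀ n {C : Set ((Vn n → ℝ) × (Vn n → ℝ))}, MeasurableSet C →
      ∫ ω in restr (Vn n) β θ ⁻¹' C, prodM W (Vn n) β θ j ω ∂P =
        ∫ x in C, ∏ l, field (wiredWeight W (Vn n)) x (wiredVertex (Vn n) (j l))
          ∂nu (wiredWeight W (Vn n)) := by
    intro n C hC
    rw [← integral_congr_ae (ae_restrict_of_ae (prodMFun_ae_eq (hnet n) j)), ← hmap n,
      setIntegral_map hC (measurable_prodMFun j).aestronglyMeasurable (hr n).aemeasurable]
    simp only [prodM_eq]
  refine ⟨hadapt, fun n m hnm => ?_⟩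
  refine (ae_eq_condExp_of_forall_setIntegral_eq ((filt Vn hmono β θ hβ hθ).le n) (hint m)
    (fun _ _ _ => (hint n).integrableOn) ?_ (hadapt n).aestronglyMeasurable).symm
  rintro _ ⟨B, hB, rfl⟩ -
  have hpre : restr (Vn n) β θ ⁻¹' B =
      restr (Vn m) β θ ⁻¹' (restrictTo (hmono hnm) ⁻¹' B) := rfl
  rw [hset n hB, hpre, hset m (measurable_restrictTo (hmono hnm) hB)]
  exact (setIntegral_prod_field_wired hsymm hpos hzero hsum j (hmono hnm) (hex m) hB).symm

end MartingaleProperty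

end HypSigma

end

theorem mainTheorem4 {V : Type*} [DecidableEq V] [Infinite V]
    (G : SimpleGraph V) (W : V → V → ℝ)
    (hsymm : ∀ i j, W i j = W j i)
    (hpos : ∀ i j, G.Adj i j → 0 < W i j)
    (hzero : ∀ i j, ¬ G.Adj i j → W i j = 0)
    (hsum : ∀ i, Summable fun j => W i j)
    (Vn : ℕ → Finset V) (hmono : Monotone Vn) (hcover : ∀ i, ∃ n, i ∈ Vn n)
    (hconn : ∀ n, (HypSigma.wiredGraph G (Vn n)).Connected)
    {Ω : Type*} [MeasurableSpace Ω] (P : Measure Ω) [IsProbabilityMeasure P]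
    (β θ : V → Ω → ℝ) (hβ : ∀ i, Measurable (β i)) (hθ : ∀ i, Measurable (θ i))
    (hlaw : HypSigma.HasInfiniteVolumeLaw W Vn P β θ) :
    (∀ (k : ℕ) (j : Fin k → V),
      Martingale (fun n ω => HypSigma.prodM W (Vn n) β θ j ω)
        (HypSigma.filt Vn hmono β θ hβ hθ) P ∧
      Martingale (fun n ω => (HypSigma.prodM W (Vn n) β θ j ω).re)
        (HypSigma.filt Vn hmono β θ hβ hθ) P ∧
      Martingale (fun n ω => (HypSigma.prodM W (Vn n) β θ j ω).im)
        (HypSigma.filt Vn hmono β θ hβ hθ) P) ∧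
    (∀ j : V,
      Martingale (fun n ω => HypSigma.sField W (Vn n) β θ j ω *
          Real.exp (HypSigma.uField W (Vn n) β θ j ω))
        (HypSigma.filt Vn hmono β θ hβ hθ) P ∧
      Martingale (fun n ω => Real.exp (2 * HypSigma.uField W (Vn n) β θ j ω) *
          (1 - HypSigma.sField W (Vn n) β θ j ω ^ 2))
        (HypSigma.filt Vn hmono β θ hβ hθ) P) := by
  have hall : ∀ (k : ℕ) (j : Fin k → V),
      Martingale (fun n ω => HypSigma.prodM W (Vn n) β θ j ω)
        (HypSigma.filt Vn hmono β θ hβ hθ) P ∧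
      Martingale (fun n ω => (HypSigma.prodM W (Vn n) β θ j ω).re)
        (HypSigma.filt Vn hmono β θ hβ hθ) P ∧
      Martingale (fun n ω => (HypSigma.prodM W (Vn n) β θ j ω).im)
        (HypSigma.filt Vn hmono β θ hβ hθ) P := by
    intro k j
    have h := HypSigma.martingale_prodM hsymm hpos hzero hsum Vn hmono hconn P hβ hθ hlaw j
    exact ⟨h, HypSigma.martingale_comp_continuousLinearMap h Complex.reCLM,
      HypSigma.martingale_comp_continuousLinearMap h Complex.imCLM⟩
  refine ⟨hall, fun j => ⟨?_, ?_⟩⟩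
  · have h : (fun n ω => HypSigma.sField W (Vn n) β θ j ω *
          Real.exp (HypSigma.uField W (Vn n) β θ j ω)) =
        fun n ω => (HypSigma.prodM W (Vn n) β θ (fun _ : Fin 1 => j) ω).im := by
      funext n ω
      simp [HypSigma.prodM, mul_comm, -Complex.ofReal_exp]
    rw [h]
    exact (hall 1 fun _ => j).2.2
  · have h : (fun n ω => Real.exp (2 * HypSigma.uField W (Vn n) β θ j ω) *
          (1 - HypSigma.sField W (Vn n) β θ j ω ^ 2)) =
        fun n ω => (HypSigma.prodM W (Vn n) β θ (fun _ : Fin 2 => j) ω).re := by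
      funext n ω
      rw [two_mul, Real.exp_add]
      simp [HypSigma.prodM, pow_two, -Complex.ofReal_exp]
      ring
    rw [h]
    exact (hall 2 fun _ => j).2.1
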